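/- For structures $\mathcal M_1,\mathcal M_2$ (in possibly different first-order languages) with the same universe $M$, say that $\mathcal M_1$ is a $\emptyset$-reduct of $\mathcal M_2$, and $\mathcal M_2$ is a $\emptyset$-expansion of $\mathcal M_1$, if for every $n\ge 1$ every subset of $M^n$ that is definable without parameters in $\mathcal M_1$ is definable without parameters in $\mathcal M_2$. The expansion is $\emptyset$-proper if, in addition, $\mathcal M_2$ is not a $\emptyset$-reduct of $\mathcal M_1$. The structures are $\emptyset$-interdefinable if each is a $\emptyset$-reduct of the other. A structure is unstable if its complete theory is unstable, i.e. some formula $\varphi(x,y)$ without parameters ($x,y$ finite tuples of variables) has the order property. Theorem. Let $(N,+,0,1,<)$ be an elementary extension of $(\mathbb Z,+,0,1,<)$. Then $(N,+,0,1,<)$ is $\emptyset$-minimal among the unstable $\emptyset$-proper $\emptyset$-expansions of $(N,+,0,1)$. That is, $(N,+,0,1,<)$ is itself an unstable $\emptyset$-proper $\emptyset$-expansion of $(N,+,0,1)$, and every unstable structure with universe $N$ (in any first-order language) that is a $\emptyset$-proper $\emptyset$-expansion of $(N,+,0,1)$ and a $\emptyset$-reduct of $(N,+,0,1,<)$ is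 $\emptyset$-interdefinable with $(N,+,0,1,<)$. -/

import Mathlib

open FirstOrder

universe u v w

/-- The relation symbols of the language `{+, 0, 1, <}`: one binary symbol. -/
inductive OrdPresburgerRel : ℕ → Type
  | lt : OrdPresburgerRel 2

/-- The language `{+, 0, 1, <}` of ordered Presburger arithmetic. -/
def ordPresburger : FirstOrder.Language where
  Functions := presburgerFunc
  Relations := OrdPresburgerRel

/-- The structure `(M, +, 0, 1, <)`. Every structure for `ordPresburger` is of this form. (The
structure `(M, +, 0, 1)` for `FirstOrder.Language.presburger` is Mathlib's.) -/
instance ordPresburgerStructure {M : Type*} [Zero M] [One M] [Add M] [LT M] :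
    ordPresburger.Structure M where
  funMap
    | .zero, _ => 0
    | .one, _ => 1
    | .add, v => v 0 + v 1
  RelMap
    | .lt, v => v 0 < v 1

section Reducts

variable {M : Type*}

/-- The `L₁`-structure on `M` is an `A`-reduct of the `L₂`-structure on `M` (equivalently, the
latter is an `A`-expansion of the former): for every `n ≥ 1`, every subset of `M ^ n` that is
`∅`-definable in the former is definable over `A` in the latter. -/
def IsReductOver (A : Set M) (L₁ L₂ : FirstOrder.Language) [L₁.Structure M] [L₂.Structure M] : Prop :=
  ∀ n : ℕ, 1 ≤ n → ∀ s : Set (Fin n → M), (∅ : Set M).Definable L₁ s → A.Definable L₂ s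

/-- The `L₂`-structure on `M` is an `A`-expansion of the `L₁`-structure on `M`. -/
def IsExpansionOver (A : Set M) (L₂ L₁ : FirstOrder.Language) [L₂.Structure M] [L₁.Structure M] : Prop :=
  IsReductOver A L₁ L₂

/-- The `L₂`-structure on `M` is a `B`-proper `A`-expansion of the `L₁`-structure on `M`. -/
def IsProperExpansionOver (B A : Set M) (L₂ L₁ : FirstOrder.Language)
    [L₂.Structure M] [L₁.Structure M] : Prop :=
  IsExpansionOver A L₂ L₁ ∧ ¬ IsReductOver B L₂ L₁

/-- The two structures on `M` are `A`-interdefinable. -/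
def InterdefinableOver (A : Set M) (L₁ L₂ : FirstOrder.Language) [L₁.Structure M] [L₂.Structure M] : Prop :=
  IsReductOver A L₁ L₂ ∧ IsReductOver A L₂ L₁

end Reducts

/-- The complete theory of the `L`-structure `M` is unstable: some formula `φ(x, y)` without
parameters, in finite tuples of variables `x` and `y`, has the order property. The order property
of `φ` is expressed here by the existence of arbitrarily long finite sequences in `M` that `φ`
orders; this depends only on the complete theory of `M`, and by compactness it is the same as the
existence of infinite such sequences in some model of that theory. -/
def IsUnstable (L : FirstOrder.Language) (M : Type*) [L.Structure M] : Prop :=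
  ∃ (m n : ℕ) (φ : L.Formula (Fin m ⊕ Fin n)), ∀ k : ℕ,
    ∃ (a : Fin k → Fin m → M) (b : Fin k → Fin n → M),
      ∀ i j : Fin k, φ.Realize (Sum.elim (a i) (b j)) ↔ i < j

/-!
Let `𝓛` be an unstable structure on `N` lying between `(N, +, 0, 1)` and `(N, +, 0, 1, <)`. Since
`ℤ` is an elementary substructure of `(N, +, 0, 1, <)`, the `∅`-definable sets of `𝓛` have traces on
the powers of `ℤ`, given by the same formulas of `{+, 0, 1, <}`. The traces are closed under the
first-order operations (`definabilityClass_definableInBoth`), and a formula defining the order of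
`ℤ` among them defines the order of `N` (`definable_lt_of_nonneg`). So it suffices to work in `ℤ`,
with a class of predicates that contains the graph of addition, is closed under first-order
operations, and all of whose members are definable in `(ℤ, +, 0, 1, <)`.

Quantifier elimination for `(ℤ, +, 0, 1, <)` (`PatternDetermined.of_definable_ordPresburger`) bounds
uniformly, for a definable family of subsets of `ℤ`, the number of changes of membership along each
residue class of a suitable modulus. If the family has members that, on a residue class, are neither
almost empty nor almost full, with no uniform bound on the exceptions, then arbitrarily long
intervals can be carved out of them definably, and hence the order is definable
(`nonneg_of_finite_fibres`, `nonneg_of_intervals`, `exists_uniform_dichotomy`).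

Otherwise each definable family consists, on residue classes, of finite and cofinite sets with a
uniform bound. This makes the structure on `ℤ` stable. In an ultrapower, count the traces
`{b | φ(c, b)}` of a tuple `c` on a countable set of parameters: a first coordinate that is generic
over the other coordinates and the parameters adds nothing but its residue class, and one that is
algebraic adds countably many choices. By induction on the length of `c`, there are only countably
many traces (`hasCountableTraces_fin`). But the order property produces a trace for each real number
in `[0, 1)`, over parameters indexed by the rationals (`nonneg_of_order_property`).

That `(N, +, 0, 1, <)` is a proper expansion of `(N, +, 0, 1)` follows from quantifier elimination
for `(ℤ, +, 0, 1)` (`not_definable_lt_presburger`).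
-/

open FirstOrder.Language Set Filter

/-! ### Definable sets and expansions -/

section DefinableInduction

variable {M : Type*} (L : FirstOrder.Language.{u, v}) [L.Structure M]

/-- Induction principle for `∅`-definable sets: a class of subsets of the finite powers of `M` that
contains the sets given by atomic formulas and is closed under complement, intersection and
projection along the last coordinate contains every `∅`-definable set. -/
theorem definable_induction (C : ∀ n : ℕ, Set (Fin n → M) → Prop)
    (hempty : ∀ n, C n ∅)
    (hcompl : ∀ n s, C n s → C n sᶜ)
    (hinter : ∀ n s t, C n s → C n t → C n (s ∩ t))
    (hex : ∀ n s, C (n + 1) s → C n {x | ∃ a, (Fin.snoc x a : Fin (n + 1) → M) ∈ s})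
    (heq : ∀ n (t₁ t₂ : L.Term (Fin n)), C n {x | t₁.realize x = t₂.realize x})
    (hrel : ∀ n k (R : L.Relations k) (ts : Fin k → L.Term (Fin n)),
      C n {x | Structure.RelMap R fun i => (ts i).realize x})
    {n : ℕ} {s : Set (Fin n → M)} (hs : (∅ : Set M).Definable L s) : C n s := by
  have key : ∀ (m : ℕ) (φ : L.BoundedFormula (Fin n) m),
      C (n + m) {x | φ.Realize (fun i => x (Fin.castAdd m i)) (fun i => x (Fin.natAdd n i))} := by
    have hterm : ∀ {m : ℕ} (t : L.Term (Fin n ⊕ Fin m)) (x : Fin (n + m) → M),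
        t.realize (Sum.elim (fun i => x (Fin.castAdd m i)) (fun i => x (Fin.natAdd n i))) =
          (t.relabel finSumFinEquiv).realize x := by
      intro m t x
      rw [Term.realize_relabel]
      congr 1
      ext i
      rcases i with i | i <;> simp
    intro m φ
    induction φ with
    | falsum => exact hempty _
    | equal t₁ t₂ =>
      simp only [BoundedFormula.Realize, hterm]
      exact heq _ _ _
    | rel R ts =>
      simp only [BoundedFormula.Realize, hterm]
      exact hrel _ _ _ _
    | imp φ ψ ih₁ ih₂ =>
      have h := hcompl _ _ (hinter _ _ _ ih₁ (hcompl _ _ ih₂))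
      convert h using 1
      ext x
      simp [BoundedFormula.Realize]
    | @all m φ ih =>
      have h := hcompl _ _ (hex (n + m) _ (hcompl _ _ ih))
      convert h using 1
      ext x
      simp only [BoundedFormula.Realize, mem_ofPred_eq, mem_compl_iff, not_exists, not_not]
      refine forall_congr' fun a => ?_
      have h1 : (fun i => (Fin.snoc x a : Fin (n + m + 1) → M) (Fin.castAdd (m + 1) i)) =
          fun i => x (Fin.castAdd m i) := by
        ext i
        exact Fin.snoc_castSucc (α := fun _ => M) a x (Fin.castAdd m i)
      have h2 : (fun i => (Fin.snoc x a : Fin (n + m + 1) → M) (Fin.natAdd n i)) =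
          (Fin.snoc (fun i => x (Fin.natAdd n i)) a : Fin (m + 1) → M) := by
        ext i
        refine Fin.lastCases ?_ (fun j => ?_) i
        · rw [Fin.snoc_last]
          exact Fin.snoc_last (α := fun _ => M) a x
        · rw [Fin.snoc_castSucc]
          exact Fin.snoc_castSucc (α := fun _ => M) a x (Fin.natAdd n j)
      exact iff_of_eq (congrArg₂ (fun p q => φ.Realize p q) h1.symm h2.symm)
  obtain ⟨φ, rfl⟩ := Set.empty_definable_iff.1 hs
  have h : C n {x | BoundedFormula.Realize (l := 0) φ (fun i => x (Fin.castAdd 0 i))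
      (fun i => x (Fin.natAdd n i))} :=
    key 0 φ
  convert h using 2
  ext x
  exact iff_of_eq (congrArg₂ (fun p q => BoundedFormula.Realize (l := 0) φ p q) rfl
    (Subsingleton.elim _ _))

end DefinableInduction

section Expansion

variable {M : Type*} (L₁ L₂ : FirstOrder.Language) [L₁.Structure M] [L₂.Structure M]

/-- If the basic functions and relations of `L₁` are `∅`-definable in `L₂`, then so is every set
that is `∅`-definable in `L₁`. -/
theorem definable_of_definable_symbols
    (hfun : ∀ k (f : L₁.Functions k), (∅ : Set M).DefinableFun L₂ (Structure.funMap (M := M) f))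
    (hrel : ∀ k (R : L₁.Relations k),
      (∅ : Set M).Definable L₂ {x : Fin k → M | Structure.RelMap R x})
    {n : ℕ} {s : Set (Fin n → M)} (hs : (∅ : Set M).Definable L₁ s) :
    (∅ : Set M).Definable L₂ s := by
  have hterm : ∀ {n : ℕ} (t : L₁.Term (Fin n)),
      (∅ : Set M).DefinableFun L₂ fun x : Fin n → M => t.realize x := by
    intro n t
    induction t with
    | var i => exact DefinableFun.proj L₂
    | func f ts ih =>
      exact DefinableFun.comp (g := fun x i => (ts i).realize x) (fun i => ih i) (hfun _ f)
  refine definable_induction L₁ (fun n s => (∅ : Set M).Definable L₂ s) (fun n => ?_)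
    (fun n s h => h.compl) (fun n s t h₁ h₂ => h₁.inter h₂) (fun n s h => ?_)
    (fun n t₁ t₂ => (hterm t₁).ofPred_eq (hterm t₂))
    (fun n k R ts => ?_) hs
  · exact definable_empty
  · convert h.image_comp (Fin.castSucc : Fin n → Fin (n + 1)) using 1
    ext x
    constructor
    · rintro ⟨a, ha⟩
      exact ⟨_, ha, by ext i; simp⟩
    · rintro ⟨y, hy, rfl⟩
      refine ⟨y (Fin.last n), ?_⟩
      convert hy using 1
      exact Fin.snoc_init_self y
  · exact (hrel k R).preimage_map (F := fun x i => (ts i).realize x) (fun i => hterm (ts i))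

end Expansion

/-! ### Quantifier elimination for the integers -/

section Patterns

/-- An affine form `x ↦ ∑ aᵢ xᵢ + b` with integer coefficients, encoded as the pair `(a, b)`. -/
abbrev AffineForm (n : ℕ) := (Fin n → ℤ) × ℤ

namespace AffineForm

variable {n : ℕ}

/-- The value of an affine form at an integer point. -/
def eval (f : AffineForm n) (x : Fin n → ℤ) : ℤ := ∑ i, f.1 i * x i + f.2

theorem eval_add (f g : AffineForm n) (x : Fin n → ℤ) :
    eval (f + g) x = eval f x + eval g x := by
  simp only [eval, Prod.fst_add, Prod.snd_add, Pi.add_apply, add_mul, Finset.sum_add_distrib]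
  ring

theorem eval_smul (c : ℤ) (f : AffineForm n) (x : Fin n → ℤ) :
    eval (c • f) x = c * eval f x := by
  simp only [eval, Prod.smul_fst, Prod.smul_snd, Pi.smul_apply, smul_eq_mul, mul_add,
    Finset.mul_sum, mul_assoc]

@[simp] theorem eval_const (c : ℤ) (x : Fin n → ℤ) : eval ((0, c) : AffineForm n) x = c := by
  simp [eval]

@[simp] theorem eval_single (i : Fin n) (x : Fin n → ℤ) :
    eval ((Pi.single i 1, 0) : AffineForm n) x = x i := by
  simp [eval, Pi.single_apply]

/-- The part of an affine form not involving the last variable. -/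
def init (f : AffineForm (n + 1)) : AffineForm n := (Fin.init f.1, f.2)

theorem eval_snoc (f : AffineForm (n + 1)) (x : Fin n → ℤ) (a : ℤ) :
    eval f (Fin.snoc x a : Fin (n + 1) → ℤ) = f.1 (Fin.last n) * a + eval f.init x := by
  simp only [eval, init, Fin.sum_univ_castSucc, Fin.snoc_castSucc, Fin.snoc_last, Fin.init]
  ring

theorem dvd_eval_sub (f : AffineForm n) {m : ℤ} {x y : Fin n → ℤ} (h : ∀ i, m ∣ x i - y i) :
    m ∣ eval f x - eval f y := by
  have : eval f x - eval f y = ∑ i, f.1 i * (x i - y i) := by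
    simp only [eval, mul_sub, Finset.sum_sub_distrib]
    ring
  rw [this]
  exact Finset.dvd_sum fun i _ => (h i).mul_left _

end AffineForm

open AffineForm

/-- The set `s` is a Boolean combination of congruences to a fixed modulus and of conditions
`T (f x)` for finitely many affine forms `f`; equivalently, membership in `s` depends only on the
residues of the coordinates and on the truth values of these conditions. One implication suffices in
the definition, since the hypotheses on `x` and `y` are symmetric. -/
def PatternDetermined (T : ℤ → Prop) (n : ℕ) (s : Set (Fin n → ℤ)) : Prop :=
  ∃ m : ℕ, 0 < m ∧ ∃ F : Finset (AffineForm n), ∀ x y : Fin n → ℤ,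
    (∀ i, (m : ℤ) ∣ x i - y i) → (∀ f ∈ F, (T (eval f x) ↔ T (eval f y))) → x ∈ s → y ∈ s

namespace PatternDetermined

variable {T : ℤ → Prop} {n : ℕ} {s t : Set (Fin n → ℤ)}

theorem empty : PatternDetermined T n ∅ :=
  ⟨1, one_pos, ∅, fun _ _ _ _ h => h⟩

theorem compl (hs : PatternDetermined T n s) : PatternDetermined T n sᶜ := by
  obtain ⟨m, hm, F, h⟩ := hs
  refine ⟨m, hm, F, fun x y hxy hF hx hy =>
    hx (h y x (fun i => ?_) (fun f hf => (hF f hf).symm) hy)⟩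
  rw [← neg_sub]
  exact (hxy i).neg_right

theorem inter (hs : PatternDetermined T n s) (ht : PatternDetermined T n t) :
    PatternDetermined T n (s ∩ t) := by
  classical
  obtain ⟨m, hm, F, h⟩ := hs
  obtain ⟨m', hm', F', h'⟩ := ht
  refine ⟨m * m', Nat.mul_pos hm hm', F ∪ F', fun x y hxy hF hx => ⟨?_, ?_⟩⟩
  · exact h x y (fun i => (Dvd.intro (m' : ℤ) (by push_cast; ring)).trans (hxy i))
      (fun f hf => hF f (by simp [hf])) hx.1
  · exact h' x y (fun i => (Dvd.intro (m : ℤ) (by push_cast; ring)).trans (hxy i))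
      (fun f hf => hF f (by simp [hf])) hx.2

theorem of_form (f : AffineForm n) : PatternDetermined T n {x | T (eval f x)} :=
  ⟨1, one_pos, {f}, fun _ _ _ h hx => (h f (by simp)).1 hx⟩

end PatternDetermined

/-- A common bound for the coefficients of the last variable in finitely many affine forms. -/
theorem exists_coeff_bound {n : ℕ} (F : Finset (AffineForm (n + 1))) :
    ∃ B : ℕ, ∀ f ∈ F, (f.1 (Fin.last n)).natAbs ≤ B :=
  ⟨∑ f ∈ F, (f.1 (Fin.last n)).natAbs, fun _ hf =>
    Finset.single_le_sum (f := fun f : AffineForm (n + 1) => (f.1 (Fin.last n)).natAbs)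
      (fun _ _ => Nat.zero_le _) hf⟩

/-- If `c a + g = t` has a solution `a` and `g' ≡ g` modulo `m * B!`, where `0 < |c| ≤ B`, then
`c a' + g' = t` has a solution `a' ≡ a` modulo `m`. -/
theorem exists_root_congr {m B : ℕ} {c a g g' : ℤ} (hc : c ≠ 0) (hB : c.natAbs ≤ B)
    (h : ((m * B.factorial : ℕ) : ℤ) ∣ g - g') :
    ∃ a' : ℤ, c * a' + g' = c * a + g ∧ (m : ℤ) ∣ a - a' := by
  have hcB : c ∣ (B.factorial : ℤ) :=
    Int.natAbs_dvd.1 (Int.natCast_dvd_natCast.2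
      (Nat.dvd_factorial (Int.natAbs_pos.2 hc) hB))
  obtain ⟨d, hd⟩ := hcB
  obtain ⟨e, he⟩ := h
  push_cast at he
  rw [hd] at he
  refine ⟨a + m * d * e, ?_, ?_⟩
  · linear_combination -he
  · exact ⟨-(d * e), by ring⟩

/-- The sign pattern of finitely many affine forms in one variable changes somewhere along every
arithmetic progression unless all the forms are constant: each point `a` has a translate `a₁` by a
multiple of `m`, with the same sign pattern, at which some nonconstant form is small. -/
theorem exists_near_root {ι : Type*} (F : Finset ι) (c g : ι → ℤ) {m B : ℕ} (hm : 0 < m)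
    (hB : ∀ i ∈ F, (c i).natAbs ≤ B) (hc : ∃ i ∈ F, c i ≠ 0) (a : ℤ) :
    ∃ a₁ : ℤ, (m : ℤ) ∣ a - a₁ ∧ (∀ i ∈ F, (0 ≤ c i * a + g i ↔ 0 ≤ c i * a₁ + g i)) ∧
      ∃ i ∈ F, c i ≠ 0 ∧ |c i * a₁ + g i| ≤ B * m := by
  classical
  obtain ⟨i₀, hi₀, hci₀⟩ := hc
  have hm' : (1 : ℤ) ≤ m := by exact_mod_cast hm
  have hchange : ∃ d : ℤ, (d = 1 ∨ d = -1) ∧ ∃ k : ℕ, ∃ i ∈ F,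
      ¬ (0 ≤ c i * a + g i ↔ 0 ≤ c i * (a + d * k * m) + g i) := by
    have hk : (((c i₀ * a + g i₀).natAbs + 1 : ℕ) : ℤ) = |c i₀ * a + g i₀| + 1 := by
      push_cast; rfl
    set v := c i₀ * a + g i₀ with hv
    have hval : ∀ d : ℤ, c i₀ * (a + d * ((v.natAbs + 1 : ℕ) : ℤ) * m) + g i₀ =
        v + (c i₀ * d) * ((|v| + 1) * m) := by
      intro d; rw [hk, hv]; ring
    have hbig : |v| + 1 ≤ (|v| + 1) * m := le_mul_of_one_le_right (by positivity) hm'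
    have habs := neg_abs_le v
    have habs' := le_abs_self v
    have hd1 : ∃ d : ℤ, (d = 1 ∨ d = -1) ∧ 1 ≤ c i₀ * d := by
      rcases lt_or_gt_of_ne hci₀ with h | h
      · exact ⟨-1, Or.inr rfl, by omega⟩
      · exact ⟨1, Or.inl rfl, by omega⟩
    obtain ⟨d, hd, hd1⟩ := hd1
    have hbig' : (|v| + 1) * m ≤ (c i₀ * d) * ((|v| + 1) * m) :=
      le_mul_of_one_le_left (by positivity) hd1
    by_cases h0 : 0 ≤ v
    · refine ⟨-d, by omega, v.natAbs + 1, i₀, hi₀, ?_⟩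
      rw [hval, ← hv, mul_neg, neg_mul]
      intro h
      have := h.1 h0
      omega
    · refine ⟨d, hd, v.natAbs + 1, i₀, hi₀, ?_⟩
      rw [hval, ← hv]
      intro h
      exact h0 (h.2 (by omega))
  obtain ⟨d, hd, hex⟩ := hchange
  -- Take the last point of the progression before the first change of sign.
  have hne : Nat.find hex ≠ 0 := by
    intro h
    have := Nat.find_spec hex
    rw [h] at this
    simp at this
  obtain ⟨k, hk⟩ := Nat.exists_eq_succ_of_ne_zero hne
  have hmin : ∀ i ∈ F, (0 ≤ c i * a + g i ↔ 0 ≤ c i * (a + d * k * m) + g i) := by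
    have := Nat.find_min hex (m := k) (by omega)
    push Not at this
    intro i hi
    have := this i hi
    tauto
  obtain ⟨i, hi, hch⟩ := Nat.find_spec hex
  rw [hk] at hch
  refine ⟨a + d * k * m, ⟨-(d * k), by ring⟩, hmin, i, hi, ?_⟩
  rw [hmin i hi] at hch
  have hstep : c i * (a + d * (k.succ : ℕ) * m) + g i =
      c i * (a + d * k * m) + g i + c i * d * m := by
    push_cast; ring
  rw [hstep] at hch
  generalize c i * (a + d * k * m) + g i = v at hch
  have hle : |c i * d * m| ≤ B * m := by
    rw [abs_mul, abs_mul]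
    have h1 : |d| = 1 := by rcases hd with rfl | rfl <;> simp
    have h2 : |c i| ≤ B := by
      rw [Int.abs_eq_natAbs]; exact_mod_cast hB i hi
    rw [h1, mul_one, Nat.abs_cast]
    gcongr
  constructor
  · intro h0
    simp [h0] at hch
  · rcases abs_cases v with h | h <;> rcases abs_cases (c i * d * m) with h' | h' <;> omega

/-- Elimination of a quantifier in the presence of the order. A witness `a` over `x` may be moved to
a point where some form `c i * a + g i` takes one of finitely many values `t`. Over a point `y` with
the same pattern for the eliminated forms, the equation `c i * a' + g i = t` then has a solution in
the same residue class, which makes all the signs agree. -/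
theorem PatternDetermined.exists_nonneg {n : ℕ} {s : Set (Fin (n + 1) → ℤ)}
    (hs : PatternDetermined (0 ≤ ·) (n + 1) s) :
    PatternDetermined (0 ≤ ·) n {x | ∃ a, (Fin.snoc x a : Fin (n + 1) → ℤ) ∈ s} := by
  classical
  obtain ⟨m, hm, F, h⟩ := hs
  obtain ⟨B, hB⟩ := exists_coeff_bound F
  let c : AffineForm (n + 1) → ℤ := fun f => f.1 (Fin.last n)
  -- When `c i * a + g i = t`, the sign of `c j * a + g j` is that of this form.
  let comb : AffineForm (n + 1) → AffineForm (n + 1) → ℤ → AffineForm n := fun i j t =>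
    |c i| • j.init + (-(SignType.sign (c i) * c j)) • i.init +
      (0, SignType.sign (c i) * c j * t)
  refine ⟨m * B.factorial, Nat.mul_pos hm (Nat.factorial_pos _),
    F.image AffineForm.init ∪ (F ×ˢ F ×ˢ Finset.Icc (-(B * m : ℤ)) (B * m)).image
      (fun p => comb p.1 p.2.1 p.2.2), ?_⟩
  rintro x y hxy hF ⟨a, ha⟩
  have hsmall : ∀ i, (m : ℤ) ∣ x i - y i := fun i =>
    (Dvd.intro (B.factorial : ℤ) (by push_cast; rfl)).trans (hxy i)
  have hsnoc : ∀ (x' y' : Fin n → ℤ) (a b : ℤ), (∀ i, (m : ℤ) ∣ x' i - y' i) → (m : ℤ) ∣ a - b →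
      ∀ i, (m : ℤ) ∣ (Fin.snoc x' a : Fin (n + 1) → ℤ) i - (Fin.snoc y' b : Fin (n + 1) → ℤ) i := by
    intro x' y' a b h₁ h₂ i
    refine Fin.lastCases ?_ (fun j => ?_) i
    · simpa using h₂
    · simpa using h₁ j
  by_cases hc : ∃ f ∈ F, c f ≠ 0
  · obtain ⟨a₁, hdvd, hsame, i, hi, hci, hle⟩ :=
      exists_near_root F c (fun f => eval f.init x) hm (fun f hf => hB f hf) hc a
    have ha₁ : (Fin.snoc x a₁ : Fin (n + 1) → ℤ) ∈ s := by
      refine h _ _ (hsnoc x x a a₁ (by simp) hdvd) (fun f hf => ?_) ha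
      rw [eval_snoc, eval_snoc]
      exact hsame f hf
    obtain ⟨a', ha', hdvd'⟩ := exists_root_congr (m := m) (a := a₁) hci (hB i hi)
      (i.init.dvd_eval_sub hxy)
    refine ⟨a', h _ _ (hsnoc x y a₁ a' hsmall hdvd') (fun j hj => ?_) ha₁⟩
    set t := c i * a₁ + eval i.init x with ht
    have hj' := hF (comb i j t) (by
      refine Finset.mem_union_right _ (Finset.mem_image.2 ⟨(i, j, t), ?_, rfl⟩)
      simp only [Finset.mem_product, Finset.mem_Icc]
      exact ⟨hi, hj, abs_le.1 hle⟩)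
    have hpos : 0 < |c i| := abs_pos.2 hci
    have hval : ∀ (z : Fin n → ℤ) (b : ℤ), c i * b + eval i.init z = t →
        eval (comb i j t) z = |c i| * (c j * b + eval j.init z) := by
      intro z b hb
      simp only [comb, eval_add, eval_smul, eval_const, ← hb]
      rw [← sign_mul_self (c i)]
      ring
    rw [hval x a₁ rfl, hval y a' ha'] at hj'
    beta_reduce at hj'
    rw [mul_nonneg_iff_of_pos_left hpos,
      mul_nonneg_iff_of_pos_left hpos] at hj'
    rw [eval_snoc, eval_snoc]
    exact hj'
  · push Not at hc
    refine ⟨a, h _ _ (hsnoc x y a a hsmall (by simp)) (fun f hf => ?_) ha⟩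
    have h1 := hF f.init (Finset.mem_union_left _ (Finset.mem_image_of_mem _ hf))
    have h2 : f.1 (Fin.last n) = 0 := hc f hf
    rw [eval_snoc, eval_snoc, h2]
    simpa using h1

/-- Elimination of a quantifier in the absence of the order. A witness is either the root of some
form, and then it is transported as such, or generic in its residue class. -/
theorem PatternDetermined.exists_eq_zero {n : ℕ} {s : Set (Fin (n + 1) → ℤ)}
    (hs : PatternDetermined (· = 0) (n + 1) s) :
    PatternDetermined (· = 0) n {x | ∃ a, (Fin.snoc x a : Fin (n + 1) → ℤ) ∈ s} := by
  classical
  obtain ⟨m, hm, F, h⟩ := hs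
  obtain ⟨B, hB⟩ := exists_coeff_bound F
  let c : AffineForm (n + 1) → ℤ := fun f => f.1 (Fin.last n)
  let comb : AffineForm (n + 1) → AffineForm (n + 1) → AffineForm n := fun i j =>
    c i • j.init + (-c j) • i.init
  refine ⟨m * B.factorial, Nat.mul_pos hm (Nat.factorial_pos _),
    F.image AffineForm.init ∪ (F ×ˢ F).image (fun p => comb p.1 p.2), ?_⟩
  rintro x y hxy hF ⟨a, ha⟩
  have hsmall : ∀ i, (m : ℤ) ∣ x i - y i := fun i =>
    (Dvd.intro (B.factorial : ℤ) (by push_cast; rfl)).trans (hxy i)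
  have hsnoc : ∀ (a b : ℤ), (m : ℤ) ∣ a - b →
      ∀ i, (m : ℤ) ∣ (Fin.snoc x a : Fin (n + 1) → ℤ) i - (Fin.snoc y b : Fin (n + 1) → ℤ) i := by
    intro a b h₂ i
    refine Fin.lastCases ?_ (fun j => ?_) i
    · simpa using h₂
    · simpa using hsmall j
  by_cases hc : ∃ i ∈ F, c i ≠ 0 ∧ c i * a + eval i.init x = 0
  · obtain ⟨i, hi, hci, h0⟩ := hc
    obtain ⟨a', ha', hdvd'⟩ := exists_root_congr (m := m) (a := a) hci (hB i hi)
      (i.init.dvd_eval_sub hxy)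
    refine ⟨a', h _ _ (hsnoc a a' hdvd') (fun j hj => ?_) ha⟩
    have hj' := hF (comb i j)
      (Finset.mem_union_right _ (Finset.mem_image.2 ⟨(i, j), by simp [hi, hj], rfl⟩))
    have hval : ∀ (z : Fin n → ℤ) (b : ℤ), c i * b + eval i.init z = 0 →
        eval (comb i j) z = c i * (c j * b + eval j.init z) := by
      intro z b hb
      simp only [comb, eval_add, eval_smul]
      linear_combination (-c j) * hb
    rw [hval x a h0, hval y a' (ha'.trans h0)] at hj'
    simp only [mul_eq_zero, hci, false_or] at hj'
    rw [eval_snoc, eval_snoc]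
    exact hj'
  · push Not at hc
    -- No nonconstant form vanishes at `a`; a large enough `a'` avoids all their roots over `y`.
    obtain ⟨K, hK⟩ : ∃ K : ℕ, ∀ f ∈ F, (eval f.init y).natAbs ≤ K :=
      ⟨∑ f ∈ F, (eval f.init y).natAbs, fun f hf =>
        Finset.single_le_sum (f := fun f : AffineForm (n + 1) => (eval f.init y).natAbs)
          (fun _ _ => Nat.zero_le _) hf⟩
    refine ⟨a + (|a| + K + 1) * m, h _ _ (hsnoc a _ ⟨-(|a| + K + 1), by ring⟩)
      (fun f hf => ?_) ha⟩
    rw [eval_snoc, eval_snoc]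
    by_cases hcf : f.1 (Fin.last n) = 0
    · have h1 := hF f.init (Finset.mem_union_left _ (Finset.mem_image_of_mem _ hf))
      rw [hcf]
      simpa using h1
    · refine iff_of_false (hc f hf hcf) fun h0 => ?_
      have hm' : (1 : ℤ) ≤ m := by exact_mod_cast hm
      have h1 : (|a| + K + 1) ≤ (|a| + K + 1) * m := le_mul_of_one_le_right (by positivity) hm'
      have h2 := neg_abs_le a
      have h3 : (K : ℤ) + 1 ≤ a + (|a| + K + 1) * m := by omega
      have h4 : ((a + (|a| + K + 1) * m : ℤ)) ≤
          |f.1 (Fin.last n)| * |a + (|a| + K + 1) * m| :=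
        (le_abs_self _).trans (le_mul_of_one_le_left (abs_nonneg _) (Int.one_le_abs hcf))
      rw [← abs_mul, eq_neg_of_add_eq_zero_left h0, abs_neg] at h4
      have h5 : |eval f.init y| ≤ K := by
        rw [Int.abs_eq_natAbs]
        exact_mod_cast hK f hf
      linarith

end Patterns

section Presburger

open AffineForm

theorem presburger_realize_eq_eval {n : ℕ} (t : FirstOrder.Language.presburger.Term (Fin n)) :
    ∃ f : AffineForm n, ∀ x : Fin n → ℤ, t.realize x = eval f x := by
  induction t with
  | var i => exact ⟨(Pi.single i 1, 0), fun x => by simp⟩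
  | func f ts ih =>
    choose g hg using ih
    cases f with
    | zero => exact ⟨(0, 0), fun x => by rw [eval_const]; rfl⟩
    | one => exact ⟨(0, 1), fun x => by rw [eval_const]; rfl⟩
    | add => exact ⟨g 0 + g 1, fun x => by rw [eval_add, ← hg, ← hg]; rfl⟩

theorem ordPresburger_realize_eq_eval {n : ℕ} (t : ordPresburger.Term (Fin n)) :
    ∃ f : AffineForm n, ∀ x : Fin n → ℤ, t.realize x = eval f x := by
  induction t with
  | var i => exact ⟨(Pi.single i 1, 0), fun x => by simp⟩
  | func f ts ih =>
    choose g hg using ih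
    cases f with
    | zero => exact ⟨(0, 0), fun x => by rw [eval_const]; rfl⟩
    | one => exact ⟨(0, 1), fun x => by rw [eval_const]; rfl⟩
    | add => exact ⟨g 0 + g 1, fun x => by rw [eval_add, ← hg, ← hg]; rfl⟩

/-- Quantifier elimination for `(ℤ, +, 0, 1)`. -/
theorem PatternDetermined.of_definable_presburger {n : ℕ} {s : Set (Fin n → ℤ)}
    (hs : (∅ : Set ℤ).Definable FirstOrder.Language.presburger s) :
    PatternDetermined (· = 0) n s := by
  refine definable_induction _ (PatternDetermined (· = 0)) (fun _ => .empty) (fun _ _ => .compl)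
    (fun _ _ _ => .inter) (fun _ _ => .exists_eq_zero) (fun n t₁ t₂ => ?_)
    (fun _ _ R => Empty.elim R) hs
  obtain ⟨f, hf⟩ := presburger_realize_eq_eval t₁
  obtain ⟨g, hg⟩ := presburger_realize_eq_eval t₂
  convert PatternDetermined.of_form (T := (· = 0)) (f + (-1 : ℤ) • g) using 2
  ext x
  rw [eval_add, eval_smul, ← hf, ← hg, neg_one_mul, ← sub_eq_add_neg, sub_eq_zero]

/-- Quantifier elimination for `(ℤ, +, 0, 1, <)`. -/
theorem PatternDetermined.of_definable_ordPresburger {n : ℕ} {s : Set (Fin n → ℤ)}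
    (hs : (∅ : Set ℤ).Definable ordPresburger s) : PatternDetermined (0 ≤ ·) n s := by
  have hle : ∀ {n : ℕ} (t₁ t₂ : ordPresburger.Term (Fin n)) (k : ℤ),
      PatternDetermined (0 ≤ ·) n {x | t₁.realize x + k ≤ t₂.realize x} := by
    intro n t₁ t₂ k
    obtain ⟨f, hf⟩ := ordPresburger_realize_eq_eval t₁
    obtain ⟨g, hg⟩ := ordPresburger_realize_eq_eval t₂
    convert PatternDetermined.of_form (T := (0 ≤ ·)) (g + (-1 : ℤ) • f + (0, -k)) using 2
    ext x
    rw [eval_add, eval_add, eval_smul, eval_const, ← hf, ← hg]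
    constructor <;> intro h <;> linarith
  refine definable_induction _ (PatternDetermined (0 ≤ ·)) (fun _ => .empty) (fun _ _ => .compl)
    (fun _ _ _ => .inter) (fun _ _ => .exists_nonneg) (fun n t₁ t₂ => ?_)
    (fun n k R ts => ?_) hs
  · convert (hle t₁ t₂ 0).inter (hle t₂ t₁ 0) using 1
    ext x
    simp [le_antisymm_iff]
  · cases R
    exact hle (ts 0) (ts 1) 1

/-- The order of `ℤ` is not definable in `(ℤ, +, 0, 1)`: pairs `(N, 0)` and `(-N, 0)` with `N`
highly divisible and away from the roots of finitely many affine forms are indistinguishable. -/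
theorem not_definable_lt_presburger :
    ¬ (∅ : Set ℤ).Definable FirstOrder.Language.presburger {x : Fin 2 → ℤ | x 0 < x 1} := by
  intro h
  obtain ⟨m, hm, F, hF⟩ := PatternDetermined.of_definable_presburger h
  obtain ⟨K, hK⟩ : ∃ K : ℕ, ∀ f ∈ F, f.2.natAbs ≤ K :=
    ⟨∑ f ∈ F, f.2.natAbs, fun f hf =>
      Finset.single_le_sum (f := fun f : AffineForm 2 => f.2.natAbs)
        (fun _ _ => Nat.zero_le _) hf⟩
  have hm' : (1 : ℤ) ≤ m := by exact_mod_cast hm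
  have hb : (K : ℤ) + 1 ≤ (K + 1) * m := le_mul_of_one_le_right (by positivity) hm'
  have := hF ![-((K + 1) * m), 0] ![(K + 1) * m, 0] ?_ ?_ (by simp; positivity)
  · simp at this
    omega
  · intro i
    fin_cases i
    · exact ⟨-(2 * (K + 1)), by simp; ring⟩
    · simp
  · intro f hf
    have hKf := hK f hf
    simp only [eval, Fin.sum_univ_two, Matrix.cons_val_zero, Matrix.cons_val_one]
    by_cases hc : f.1 0 = 0
    · simp [hc]
    · have hbig : (K : ℤ) + 1 ≤ |f.1 0 * ((K + 1) * m)| := by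
        rw [abs_mul, abs_of_nonneg (a := (K + 1) * (m : ℤ)) (by positivity)]
        exact hb.trans (le_mul_of_one_le_left (by positivity) (Int.one_le_abs hc))
      rw [mul_neg]
      generalize f.1 0 * ((K + 1) * (m : ℤ)) = v at hbig
      rcases abs_cases v with h' | h' <;> constructor <;> intro <;> omega

end Presburger

/-! ### A calculus of definable predicates on the integers -/

section Definability

/-- A class of predicates on tuples of integers with the closure properties of the `∅`-definable
predicates of an expansion of `(ℤ, +, 0, 1)`, all of whose members are definable in
`(ℤ, +, 0, 1, <)`. The last property enters through quantifier elimination. -/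
class DefinabilityClass (𝒟 : ∀ α : Type, ((α → ℤ) → Prop) → Prop) : Prop where
  not : ∀ {α P}, 𝒟 α P → 𝒟 α fun v => ¬ P v
  and : ∀ {α P Q}, 𝒟 α P → 𝒟 α Q → 𝒟 α fun v => P v ∧ Q v
  reindex : ∀ {α β P} (f : α → β), 𝒟 α P → 𝒟 β fun v => P (v ∘ f)
  ex : ∀ {α β P} [Finite β], 𝒟 (α ⊕ β) P → 𝒟 α fun v => ∃ w : β → ℤ, P (Sum.elim v w)
  eq : 𝒟 (Fin 2) fun v => v 0 = v 1
  one : 𝒟 (Fin 1) fun v => v 0 = 1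
  add : 𝒟 (Fin 3) fun v => v 0 + v 1 = v 2
  det : ∀ {n P}, 𝒟 (Fin n) P → PatternDetermined (0 ≤ ·) n {v | P v}

/-- A type whose elements are given by finitely many integer coordinates. -/
class Coordinates (X : Type) where
  /-- The index type of the coordinates. -/
  ι : Type
  fin : Finite ι
  /-- The tuple of coordinates of an element. -/
  equiv : X ≃ (ι → ℤ)

attribute [instance] Coordinates.fin

namespace Coordinates

instance : Coordinates ℤ := ⟨Unit, inferInstance, (Equiv.funUnique Unit ℤ).symm⟩

instance (n : ℕ) : Coordinates (Fin n → ℤ) := ⟨Fin n, inferInstance, Equiv.refl _⟩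

instance {X Y : Type} [Coordinates X] [Coordinates Y] : Coordinates (X × Y) :=
  ⟨ι X ⊕ ι Y, inferInstance,
    (Equiv.prodCongr equiv equiv).trans (Equiv.sumArrowEquivProdArrow _ _ _).symm⟩

variable {X Y Z : Type} [Coordinates X] [Coordinates Y] [Coordinates Z]

/-- A map whose coordinates are coordinates of its argument. -/
def IsReindexing (f : X → Y) : Prop :=
  ∃ σ : ι Y → ι X, ∀ x j, equiv (f x) j = equiv x (σ j)

theorem IsReindexing.id : IsReindexing fun x : X => x := ⟨_root_.id, fun _ _ => rfl⟩

theorem IsReindexing.fst : IsReindexing (Prod.fst : X × Y → X) := ⟨Sum.inl, fun _ _ => rfl⟩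

theorem IsReindexing.snd : IsReindexing (Prod.snd : X × Y → Y) := ⟨Sum.inr, fun _ _ => rfl⟩

theorem IsReindexing.comp {g : Y → Z} {f : X → Y} (hg : IsReindexing g) (hf : IsReindexing f) :
    IsReindexing fun x => g (f x) := by
  obtain ⟨σ, hσ⟩ := hg
  obtain ⟨τ, hτ⟩ := hf
  exact ⟨τ ∘ σ, fun x j => by rw [hσ, hτ]; rfl⟩

theorem IsReindexing.pair {f : X → Y} {g : X → Z} (hf : IsReindexing f) (hg : IsReindexing g) :
    IsReindexing fun x => (f x, g x) := by
  obtain ⟨σ, hσ⟩ := hf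
  obtain ⟨τ, hτ⟩ := hg
  refine ⟨Sum.elim σ τ, fun x j => ?_⟩
  rcases j with j | j
  · exact hσ x j
  · exact hτ x j

theorem IsReindexing.eval {n : ℕ} (i : Fin n) : IsReindexing fun x : Fin n → ℤ => x i :=
  ⟨fun _ => i, fun _ _ => rfl⟩

theorem IsReindexing.cons {n : ℕ} :
    IsReindexing fun p : ℤ × (Fin n → ℤ) => (Fin.cons p.1 p.2 : Fin (n + 1) → ℤ) := by
  refine ⟨Fin.cons (Sum.inl ()) Sum.inr, fun x j => ?_⟩
  refine Fin.cases ?_ (fun i => ?_) j <;> rfl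

end Coordinates

open Coordinates

variable (𝒟 : ∀ α : Type, ((α → ℤ) → Prop) → Prop)
variable {X Y Z W : Type} [Coordinates X] [Coordinates Y] [Coordinates Z] [Coordinates W]

/-- The predicate `P` belongs to the class `𝒟` when written in coordinates. -/
def DefPred (P : X → Prop) : Prop := 𝒟 (ι X) fun v => P (equiv.symm v)

/-- Substituting `f` into a predicate of the class `𝒟`, possibly with further variables, gives a
predicate of the class. -/
structure DefFun (f : X → Y) : Prop where
  subst : ∀ {Z : Type} [Coordinates Z] {P : Y → Z → Prop},
    DefPred 𝒟 (fun p : Y × Z => P p.1 p.2) → DefPred 𝒟 fun p : X × Z => P (f p.1) p.2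

variable {𝒟}

theorem DefFun.comp {g : Y → Z} {f : X → Y} (hg : DefFun 𝒟 g) (hf : DefFun 𝒟 f) :
    DefFun 𝒟 fun x => g (f x) :=
  ⟨fun {_} _ {P} h => hf.subst (P := fun y w => P (g y) w) (hg.subst h)⟩

variable [DefinabilityClass 𝒟]

namespace DefPred

theorem not {P : X → Prop} (h : DefPred 𝒟 P) : DefPred 𝒟 fun x => ¬ P x :=
  DefinabilityClass.not (𝒟 := 𝒟) h

theorem and {P Q : X → Prop} (h : DefPred 𝒟 P) (h' : DefPred 𝒟 Q) :
    DefPred 𝒟 fun x => P x ∧ Q x :=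
  DefinabilityClass.and (𝒟 := 𝒟) h h'

theorem imp {P Q : X → Prop} (h : DefPred 𝒟 P) (h' : DefPred 𝒟 Q) :
    DefPred 𝒟 fun x => P x → Q x := by
  convert (h.and h'.not).not using 2
  tauto

theorem or {P Q : X → Prop} (h : DefPred 𝒟 P) (h' : DefPred 𝒟 Q) :
    DefPred 𝒟 fun x => P x ∨ Q x := by
  convert (h.not.and h'.not).not using 2
  tauto

theorem iff {P Q : X → Prop} (h : DefPred 𝒟 P) (h' : DefPred 𝒟 Q) :
    DefPred 𝒟 fun x => P x ↔ Q x := by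
  convert (h.imp h').and (h'.imp h) using 2
  tauto

theorem ex {P : X → Y → Prop} (h : DefPred 𝒟 fun p : X × Y => P p.1 p.2) :
    DefPred 𝒟 fun x => ∃ y, P x y := by
  have := DefinabilityClass.ex (𝒟 := 𝒟) h
  refine (congrArg (𝒟 (ι X)) (funext fun v => propext ?_)).mp this
  constructor
  · rintro ⟨w, hw⟩
    exact ⟨equiv.symm w, hw⟩
  · rintro ⟨y, hy⟩
    refine ⟨equiv y, ?_⟩
    have hpair : (equiv (X := X × Y)).symm (Sum.elim v (equiv y)) = (equiv.symm v, y) := by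
      rw [Equiv.symm_apply_eq]
      change _ = Sum.elim (equiv (equiv.symm v)) (equiv y)
      rw [Equiv.apply_symm_apply]
    rw [hpair]
    exact hy

theorem all {P : X → Y → Prop} (h : DefPred 𝒟 fun p : X × Y => P p.1 p.2) :
    DefPred 𝒟 fun x => ∀ y, P x y := by
  convert (ex (P := fun x y => ¬ P x y) h.not).not using 2
  simp

theorem of_isReindexing {P : Y → Prop} (h : DefPred 𝒟 P) {f : X → Y} (hf : IsReindexing f) :
    DefPred 𝒟 fun x => P (f x) := by
  obtain ⟨σ, hσ⟩ := hf
  have := DefinabilityClass.reindex (𝒟 := 𝒟) σ h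
  refine (congrArg (𝒟 (ι X)) (funext fun v => congrArg P ?_)).mp this
  rw [Equiv.symm_apply_eq]
  ext j
  rw [hσ]
  simp

theorem comp {P : Y → Prop} (h : DefPred 𝒟 P) {f : X → Y} (hf : DefFun 𝒟 f) :
    DefPred 𝒟 fun x => P (f x) :=
  of_isReindexing (hf.subst (Z := X) (P := fun y _ => P y) (h.of_isReindexing .fst))
    (f := fun x => (x, x)) (.pair .id .id)

end DefPred

namespace DefFun

theorem of_isReindexing {f : X → Y} (hf : IsReindexing f) : DefFun 𝒟 f :=
  ⟨fun {Z} _ {P} h => DefPred.of_isReindexing (P := fun p : Y × Z => P p.1 p.2) h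
    (f := fun p : X × Z => (f p.1, p.2)) (.pair (hf.comp .fst) .snd)⟩

theorem of_graph {f : X → Y} (hf : DefPred 𝒟 fun p : X × Y => f p.1 = p.2) : DefFun 𝒟 f := by
  refine ⟨fun {Z} _ {P} h => ?_⟩
  have h1 : DefPred 𝒟 fun p : (X × Z) × Y => f p.1.1 = p.2 ∧ P p.2 p.1.2 :=
    (hf.of_isReindexing (f := fun p : (X × Z) × Y => (p.1.1, p.2))
      (.pair (.comp .fst .fst) .snd)).and
    (h.of_isReindexing (f := fun p : (X × Z) × Y => (p.2, p.1.2))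
      (.pair .snd (.comp .snd .fst)))
  convert DefPred.ex (P := fun (q : X × Z) y => f q.1 = y ∧ P y q.2) h1 using 2
  simp

theorem id : DefFun 𝒟 fun x : X => x := of_isReindexing .id

theorem fst {f : X → Y × Z} (hf : DefFun 𝒟 f) : DefFun 𝒟 fun x => (f x).1 :=
  (of_isReindexing .fst).comp hf

theorem snd {f : X → Y × Z} (hf : DefFun 𝒟 f) : DefFun 𝒟 fun x => (f x).2 :=
  (of_isReindexing .snd).comp hf

theorem eval {n : ℕ} {f : X → Fin n → ℤ} (hf : DefFun 𝒟 f) (i : Fin n) :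
    DefFun 𝒟 fun x => f x i :=
  (of_isReindexing (.eval i)).comp hf

theorem pair {f : X → Y} {g : X → Z} (hf : DefFun 𝒟 f) (hg : DefFun 𝒟 g) :
    DefFun 𝒟 fun x => (f x, g x) := by
  refine ⟨fun {W} _ {P} h => ?_⟩
  have h1 := hf.subst (Z := Z × W) (P := fun y q => P (y, q.1) q.2)
    (h.of_isReindexing (f := fun p : Y × Z × W => ((p.1, p.2.1), p.2.2))
      (.pair (.pair .fst (.comp .fst .snd)) (.comp .snd .snd)))
  have h2 := hg.subst (Z := X × W) (P := fun z q => P (f q.1, z) q.2)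
    (h1.of_isReindexing (f := fun p : Z × X × W => (p.2.1, p.1, p.2.2))
      (.pair (.comp .fst .snd) (.pair .fst (.comp .snd .snd))))
  exact h2.of_isReindexing (f := fun p : X × W => (p.1, p.1, p.2))
    (.pair .fst (.pair .fst .snd))

end DefFun

theorem DefPred.comp₂ {P : Y → Z → Prop} (h : DefPred 𝒟 fun p : Y × Z => P p.1 p.2)
    {f : X → Y} {g : X → Z} (hf : DefFun 𝒟 f) (hg : DefFun 𝒟 g) :
    DefPred 𝒟 fun x => P (f x) (g x) :=
  h.comp (f := fun x => (f x, g x)) (hf.pair hg)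

theorem DefPred.comp₃ {P : Y → Z → W → Prop} (h : DefPred 𝒟 fun p : Y × Z × W => P p.1 p.2.1 p.2.2)
    {f : X → Y} {g : X → Z} {k : X → W} (hf : DefFun 𝒟 f) (hg : DefFun 𝒟 g) (hk : DefFun 𝒟 k) :
    DefPred 𝒟 fun x => P (f x) (g x) (k x) :=
  h.comp (f := fun x => (f x, g x, k x)) (hf.pair (hg.pair hk))

theorem DefPred.eq {f g : X → ℤ} (hf : DefFun 𝒟 f) (hg : DefFun 𝒟 g) :
    DefPred 𝒟 fun x => f x = g x := by
  have : DefPred 𝒟 fun p : ℤ × ℤ => p.1 = p.2 :=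
    DefinabilityClass.reindex (𝒟 := 𝒟) ![Sum.inl (), Sum.inr ()] DefinabilityClass.eq
  exact this.comp₂ hf hg

namespace DefFun

theorem add {f g : X → ℤ} (hf : DefFun 𝒟 f) (hg : DefFun 𝒟 g) : DefFun 𝒟 fun x => f x + g x := by
  have : DefPred 𝒟 fun p : (ℤ × ℤ) × ℤ => p.1.1 + p.1.2 = p.2 :=
    DefinabilityClass.reindex (𝒟 := 𝒟) ![Sum.inl (Sum.inl ()), Sum.inl (Sum.inr ()), Sum.inr ()]
      DefinabilityClass.add
  exact (of_graph (f := fun p : ℤ × ℤ => p.1 + p.2) this).comp (hf.pair hg)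

theorem sub {f g : X → ℤ} (hf : DefFun 𝒟 f) (hg : DefFun 𝒟 g) : DefFun 𝒟 fun x => f x - g x := by
  refine of_graph ?_
  have : DefPred 𝒟 fun p : X × ℤ => p.2 + g p.1 = f p.1 :=
    .eq (.add (.snd .id) (hg.comp (.fst .id))) (hf.comp (.fst .id))
  convert this using 2
  rw [sub_eq_iff_eq_add, eq_comm]

theorem const (c : ℤ) : DefFun 𝒟 fun _ : X => c := by
  have one : DefFun 𝒟 fun _ : X => (1 : ℤ) := by
    have : DefPred 𝒟 fun y : ℤ => y = 1 :=
      DefinabilityClass.reindex (𝒟 := 𝒟) ![()] DefinabilityClass.one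
    refine of_graph ?_
    convert this.comp (f := fun p : X × ℤ => p.2) (.snd .id) using 2
    exact eq_comm
  induction c with
  | zero => simpa using one.sub one
  | succ n ih => exact ih.add one
  | pred n ih => exact ih.sub one

theorem const_mul (c : ℤ) {f : X → ℤ} (hf : DefFun 𝒟 f) : DefFun 𝒟 fun x => c * f x := by
  induction c with
  | zero => simpa using const (𝒟 := 𝒟) (X := X) 0
  | succ n ih => simpa [add_mul] using ih.add hf
  | pred n ih => simpa [sub_mul] using ih.sub hf

end DefFun

theorem DefPred.const (p : Prop) : DefPred 𝒟 fun _ : X => p := by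
  by_cases h : p
  · convert DefPred.eq (DefFun.const (𝒟 := 𝒟) (X := X) 0) (.const 0) using 2
    simp [h]
  · convert (DefPred.eq (DefFun.const (𝒟 := 𝒟) (X := X) 0) (.const 0)).not using 2
    simp [h]

theorem DefPred.forall_finite {κ : Type*} [Finite κ] {P : κ → X → Prop}
    (h : ∀ i, DefPred 𝒟 (P i)) : DefPred 𝒟 fun x => ∀ i, P i x := by
  classical
  have hs : ∀ s : Finset κ, DefPred 𝒟 fun x => ∀ i ∈ s, P i x := by
    intro s
    induction s using Finset.induction_on with
    | empty => simpa using DefPred.const True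
    | insert a s _ ih => simpa using (h a).and ih
  have := Fintype.ofFinite κ
  simpa using hs Finset.univ

theorem DefPred.congruence {f : X → ℤ} (hf : DefFun 𝒟 f) (m r : ℤ) :
    DefPred 𝒟 fun x => m ∣ f x - r := by
  have : DefPred 𝒟 fun x => ∃ z : ℤ, f x - r = m * z :=
    .ex (.eq (.sub (hf.comp (.fst .id)) (.const r)) (.const_mul m (.snd .id)))
  exact this

end Definability

/-! ### Defining the order from long intervals -/

section Boundary

/-- The boundary of a finite set of integers: the points after which membership changes. -/
def intBoundary (T : Finset ℤ) : Finset ℤ :=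
  (T ∪ T.image (· - 1)).filter fun x => ¬ (x ∈ T ↔ x + 1 ∈ T)

theorem mem_intBoundary {T : Finset ℤ} {x : ℤ} : x ∈ intBoundary T ↔ ¬ (x ∈ T ↔ x + 1 ∈ T) := by
  simp only [intBoundary, Finset.mem_filter, Finset.mem_union, Finset.mem_image,
    sub_eq_iff_eq_add, exists_eq_right, and_iff_right_iff_imp]
  tauto

theorem exists_boundary_between (T : Finset ℤ) (a : ℤ) (i : ℕ) (h : ¬ (a ∈ T ↔ a + i ∈ T)) :
    ∃ z ∈ intBoundary T, a ≤ z ∧ z < a + i := by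
  induction i with
  | zero => simp at h
  | succ i ih =>
    by_cases h' : a ∈ T ↔ a + i ∈ T
    · refine ⟨a + i, mem_intBoundary.2 fun h2 => h ?_, by omega, by push_cast; omega⟩
      rw [h', h2]
      push_cast
      rw [add_assoc]
    · obtain ⟨z, hz, h1, h2⟩ := ih h'
      exact ⟨z, hz, h1, by push_cast; omega⟩

theorem card_intBoundary_lt {T T' : Finset ℤ} {b z₁ z₂ : ℤ} (h₁ : z₁ ∈ intBoundary T)
    (h₂ : z₂ ∈ intBoundary T) (hne : z₁ ≠ z₂)
    (h : ∀ x ∈ intBoundary T', x ≠ b → x ∈ intBoundary T ∧ x ≠ z₁ ∧ x ≠ z₂) :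
    (intBoundary T').card < (intBoundary T).card := by
  have hsub : intBoundary T' ⊆ insert b (((intBoundary T).erase z₁).erase z₂) := by
    intro x hx
    by_cases hxb : x = b
    · simp [hxb]
    · obtain ⟨h3, h4, h5⟩ := h x hx hxb
      simp [h3, h4, h5]
  have hc := (Finset.card_le_card hsub).trans (Finset.card_insert_le _ _)
  have h₂' : z₂ ∈ (intBoundary T).erase z₁ := Finset.mem_erase.2 ⟨hne.symm, h₂⟩
  have e1 := Finset.card_erase_add_one h₂'
  have e2 := Finset.card_erase_add_one h₁
  omega

/-- Removing an initial segment of length `k` from a set that does not start with an interval of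
length `k` destroys two boundary points and creates at most one. -/
theorem card_intBoundary_sdiff_min {T : Finset ℤ} {p : ℤ} (hp : p ∈ T) (hmin : ∀ x ∈ T, p ≤ x)
    {k i : ℕ} (hi : i < k) (hpi : p + i ∉ T) :
    (intBoundary (T \ Finset.Ico p (p + k))).card < (intBoundary T).card := by
  obtain ⟨z, hz, h1, h2⟩ := exists_boundary_between T p i (by simp [hp, hpi])
  have hp1 : p - 1 ∉ T := fun h => by have := hmin _ h; omega
  refine card_intBoundary_lt (b := p + k - 1) (z₁ := p - 1) (z₂ := z)
    (mem_intBoundary.2 (by simp [hp, hp1])) hz (by omega) fun x hx hxb => ?_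
  rw [mem_intBoundary] at hx ⊢
  simp only [Finset.mem_sdiff, Finset.mem_Ico] at hx
  have hm := hmin x
  have hm' := hmin (x + 1)
  rcases lt_or_ge x (p + k) with h | h
  · exfalso
    apply hx
    constructor
    · intro h'; have := hm h'.1; omega
    · intro h'; have := hm' h'.1; omega
  · refine ⟨fun h' => hx ?_, by omega, by omega⟩
    rw [h']
    exact and_congr_right fun _ => by omega

/-- The mirror image of `card_intBoundary_sdiff_min`. -/
theorem card_intBoundary_sdiff_max {T : Finset ℤ} {q : ℤ} (hq : q ∈ T) (hmax : ∀ x ∈ T, x ≤ q)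
    {k i : ℕ} (hi : i < k) (hqi : q - i ∉ T) :
    (intBoundary (T \ Finset.Ico (q - k + 1) (q - k + 1 + k))).card < (intBoundary T).card := by
  obtain ⟨z, hz, h1, h2⟩ := exists_boundary_between T (q - i) i (by simp [hq, hqi])
  have hq1 : q + 1 ∉ T := fun h => by have := hmax _ h; omega
  refine card_intBoundary_lt (b := q - k) (z₁ := q) (z₂ := z)
    (mem_intBoundary.2 (by simp [hq, hq1])) hz (by omega) fun x hx hxb => ?_
  rw [mem_intBoundary] at hx ⊢
  simp only [Finset.mem_sdiff, Finset.mem_Ico] at hx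
  have hm := hmax x
  have hm' := hmax (x + 1)
  rcases lt_or_ge (q - k) x with h | h
  · exfalso
    apply hx
    constructor
    · intro h'; have := hm h'.1; omega
    · intro h'; have := hm' h'.1; omega
  · refine ⟨fun h' => hx ?_, by omega, by omega⟩
    rw [h']
    exact and_congr_right fun _ => by omega

end Boundary

section OrderDefinable

open Coordinates

variable {𝒟 : ∀ α : Type, ((α → ℤ) → Prop) → Prop} [DefinabilityClass 𝒟]
variable {Y : Type} [Coordinates Y]

/-- A definable family containing all the intervals `[0, k)` defines the order: the conditions on
the parameter `y` say that the fibre is symmetric about some point, is closed under the predecessor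
except at `0`, and meets its negative in `0` at most; no such set has a negative element. -/
theorem nonneg_of_intervals {P : ℤ → Y → Prop} (hP : DefPred 𝒟 fun p : ℤ × Y => P p.1 p.2)
    (h : ∀ k : ℕ, ∃ y, ∀ x, P x y ↔ 0 ≤ x ∧ x < k) : DefPred 𝒟 fun x : ℤ => 0 ≤ x := by
  have key : DefPred 𝒟 fun x : ℤ => ∃ p : Y × ℤ, P x p.1 ∧ ∀ u : ℤ, P u p.1 →
      P (p.2 - u) p.1 ∧ (u = 0 ∨ P (u - 1) p.1) ∧ (P (0 - u) p.1 → u = 0) := by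
    have hu : DefFun 𝒟 fun q : (ℤ × Y × ℤ) × ℤ => q.2 := .snd .id
    have hy : DefFun 𝒟 fun q : (ℤ × Y × ℤ) × ℤ => q.1.2.1 := .fst (.snd (.fst .id))
    have hz : DefFun 𝒟 fun q : (ℤ × Y × ℤ) × ℤ => q.1.2.2 := .snd (.snd (.fst .id))
    refine .ex (.and (hP.comp₂ (.fst .id) (.fst (.snd .id))) (.all (.imp (hP.comp₂ hu hy) ?_)))
    exact .and (hP.comp₂ (hz.sub hu) hy) (.and
      (.or (.eq hu (.const 0)) (hP.comp₂ (hu.sub (.const 1)) hy))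
      (.imp (hP.comp₂ (DefFun.sub (.const 0) hu) hy) (.eq hu (.const 0))))
  convert key using 2 with x
  constructor
  · intro hx
    obtain ⟨y, hy⟩ := h (x.toNat + 1)
    refine ⟨(y, x), ?_, fun u hu => ?_⟩
    · rw [hy]; omega
    · simp only [hy] at hu ⊢
      omega
  · rintro ⟨⟨y, z⟩, hx, hy⟩
    by_contra hneg
    have hdown : ∀ n : ℕ, P (x - n) y := by
      intro n
      induction n with
      | zero => simpa using hx
      | succ n ih =>
        rcases (hy _ ih).2.1 with h0 | h0
        · omega
        · convert h0 using 1; push_cast; ring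
    obtain ⟨w, hw⟩ : ∃ w, w = z - (x - (z.natAbs + 2 * x.natAbs : ℕ)) := ⟨_, rfl⟩
    have h1 : P w y := by
      rw [hw]
      exact (hy _ (hdown _)).1
    have h2 : P (0 - w) y := by
      convert hdown (x + w).toNat using 1
      omega
    have := (hy _ h1).2.2 h2
    omega

/-- A definable family of finite sets of unbounded size, with bounded boundaries, defines the order.
If the sets begin and end with long intervals, intersecting with a translate isolates an interval;
otherwise a short initial or final segment can be removed, which shrinks the boundary. -/
theorem nonneg_of_finite_fibres (s : ℕ) : ∀ {Y : Type} [Coordinates Y] {P : ℤ → Y → Prop},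
    DefPred 𝒟 (fun p : ℤ × Y => P p.1 p.2) →
    (∀ k : ℕ, ∃ y, ∃ T : Finset ℤ, (∀ x, P x y ↔ x ∈ T) ∧ (intBoundary T).card ≤ s ∧ k ≤ T.card) →
    DefPred 𝒟 fun x : ℤ => 0 ≤ x := by
  induction s with
  | zero =>
    intro Y _ P hP h
    obtain ⟨y, T, hT, hs, hk⟩ := h 1
    have hne : T.Nonempty := Finset.card_pos.1 hk
    have hmem : T.max' hne ∈ intBoundary T := by
      refine mem_intBoundary.2 fun h => ?_
      have := T.le_max' _ (h.1 (T.max'_mem hne))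
      omega
    rw [Finset.card_eq_zero.1 (Nat.le_zero.1 hs)] at hmem
    simp at hmem
  | succ s ih =>
    intro Y _ P hP h
    by_cases hA : ∀ k : ℕ, ∃ y, ∃ p q : ℤ, (∀ x, P x y → p ≤ x ∧ x ≤ q) ∧
        ∀ i : ℤ, 0 ≤ i → i < k → P (p + i) y ∧ P (q - i) y
    -- The translate moving the first `k` elements onto the last `k` meets the fibre in just those.
    · have hQ : DefPred 𝒟 fun r : ℤ × Y × ℤ × ℤ =>
          P (r.1 + r.2.2.2) r.2.1 ∧ P (r.1 + r.2.2.2 - r.2.2.1) r.2.1 := by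
        have hx : DefFun 𝒟 fun r : ℤ × Y × ℤ × ℤ => r.1 := .fst .id
        have hy : DefFun 𝒟 fun r : ℤ × Y × ℤ × ℤ => r.2.1 := .fst (.snd .id)
        have ht : DefFun 𝒟 fun r : ℤ × Y × ℤ × ℤ => r.2.2.1 := .fst (.snd (.snd .id))
        have hu : DefFun 𝒟 fun r : ℤ × Y × ℤ × ℤ => r.2.2.2 := .snd (.snd (.snd .id))
        exact .and (hP.comp₂ (hx.add hu) hy) (hP.comp₂ ((hx.add hu).sub ht) hy)
      refine nonneg_of_intervals
        (P := fun x (r : Y × ℤ × ℤ) => P (x + r.2.2) r.1 ∧ P (x + r.2.2 - r.2.1) r.1) hQ fun k => ?_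
      obtain ⟨y, p, q, hb, hi⟩ := hA k
      refine ⟨(y, q - k + 1 - p, q - k + 1), fun x => ⟨fun hx => ?_, fun hx => ⟨?_, ?_⟩⟩⟩
      · have h1 := hb _ hx.1
        have h2 := hb _ hx.2
        dsimp only at h1 h2
        omega
      · convert (hi (k - 1 - x) (by omega) (by omega)).2 using 1
        ring
      · convert (hi x hx.1 hx.2).1 using 1
        ring
    · push Not at hA
      obtain ⟨k₀, hk₀⟩ := hA
      have hQ : DefPred 𝒟 fun r : ℤ × Y × ℤ =>
          P r.1 r.2.1 ∧ ∀ i : Fin k₀, ¬ r.1 = r.2.2 + (i : ℤ) :=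
        .and (hP.comp₂ (.fst .id) (.fst (.snd .id))) (.forall_finite fun i =>
          (DefPred.eq (.fst .id) (.add (.snd (.snd .id)) (.const _))).not)
      refine ih (P := fun x (r : Y × ℤ) => P x r.1 ∧ ∀ i : Fin k₀, ¬ x = r.2 + (i : ℤ)) hQ
        fun k => ?_
      obtain ⟨y, T, hT, hs, hk⟩ := h (k + k₀ + 1)
      have hne : T.Nonempty := Finset.card_pos.1 (by omega)
      obtain ⟨i, hi0, hik, hi⟩ := hk₀ y (T.min' hne) (T.max' hne) fun x hx =>
        ⟨T.min'_le _ ((hT x).1 hx), T.le_max' _ ((hT x).1 hx)⟩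
      obtain ⟨n, rfl⟩ := Int.eq_ofNat_of_zero_le hi0
      have hcut : ∃ c : ℤ,
          (intBoundary (T \ Finset.Ico c (c + k₀))).card < (intBoundary T).card := by
        by_cases hpn : P (T.min' hne + n) y
        · exact ⟨_, card_intBoundary_sdiff_max (T.max'_mem hne) (fun x hx => T.le_max' _ hx)
            (by exact_mod_cast hik) (fun h => hi hpn ((hT _).2 h))⟩
        · exact ⟨_, card_intBoundary_sdiff_min (T.min'_mem hne) (fun x hx => T.min'_le _ hx)
            (by exact_mod_cast hik) (fun h => hpn ((hT _).2 h))⟩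
      obtain ⟨c, hc⟩ := hcut
      refine ⟨(y, c), T \ Finset.Ico c (c + k₀), fun x => ?_, by omega, ?_⟩
      · rw [Finset.mem_sdiff, hT, Finset.mem_Ico]
        refine and_congr_right fun _ => ⟨fun h1 h2 => ?_, fun h1 j hj => h1 ?_⟩
        · exact h1 ⟨(x - c).toNat, by omega⟩ (by simp only; omega)
        · have := j.2
          omega
      · have h1 := Finset.le_card_sdiff (Finset.Ico c (c + k₀)) T
        rw [Int.card_Ico] at h1
        omega

end OrderDefinable

/-! ### Uniform finiteness -/

section Tame

open Coordinates AffineForm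

variable {𝒟 : ∀ α : Type, ((α → ℤ) → Prop) → Prop} [DefinabilityClass 𝒟]
variable {Y : Type} [Coordinates Y]

/-- Uniform finiteness: along the residue classes of a suitable modulus, membership in the fibres of
a definable family changes a bounded number of times. -/
theorem exists_bounded_boundary {P : ℤ → Y → Prop} (hP : DefPred 𝒟 fun p : ℤ × Y => P p.1 p.2) :
    ∃ m : ℕ, 0 < m ∧ ∃ K : ℕ, ∀ (y : Y) (r : ℤ), ∃ B : Finset ℤ, B.card ≤ K ∧
      ∀ x ∉ B, (P (r + m * x) y ↔ P (r + m * (x + 1)) y) := by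
  classical
  obtain ⟨n, ⟨e⟩⟩ := Finite.exists_equiv_fin (ι (ℤ × Y))
  obtain ⟨m, hm, F, hF⟩ := DefinabilityClass.det (𝒟 := 𝒟)
    (DefinabilityClass.reindex (𝒟 := 𝒟) e hP)
  refine ⟨m, hm, F.card, fun y r => ?_⟩
  let pt : ℤ → Fin n → ℤ := fun x => equiv (x, y) ∘ e.symm
  have hpt : ∀ x, ((equiv (X := ℤ × Y)).symm (pt x ∘ e)) = (x, y) := by
    intro x
    simp [pt, Function.comp_assoc]
  let j : Fin n := e (Sum.inl ())
  have hcoord : ∀ x x' i, pt x i - pt x' i = if i = j then x - x' else 0 := by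
    intro x x' i
    obtain ⟨i, rfl⟩ := e.surjective i
    rcases i with i | i
    · have : (Sum.inl i : ι (ℤ × Y)) = (Sum.inl () : ι ℤ ⊕ ι Y) := rfl
      simp only [pt, j, Function.comp_apply, Equiv.symm_apply_apply, this, if_true]
      rfl
    · have : (Sum.inr i : ι (ℤ × Y)) ≠ (Sum.inl () : ι ℤ ⊕ ι Y) := Sum.inr_ne_inl
      simp only [pt, j, Function.comp_apply, Equiv.symm_apply_apply, e.injective.eq_iff, this,
        if_false]
      exact sub_self _
  have hstep : ∀ (f : AffineForm n) x x',
      eval f (pt x) - eval f (pt x') = f.1 j * (x - x') := by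
    intro f x x'
    have : eval f (pt x) - eval f (pt x') = ∑ i, f.1 i * (pt x i - pt x' i) := by
      simp only [eval, mul_sub, Finset.sum_sub_distrib]
      ring
    rw [this]
    simp [hcoord]
  -- An affine form is monotone or antitone along the progression: its sign changes at most once.
  have hroot : ∀ f : AffineForm n, ∃ B : Finset ℤ, B.card ≤ 1 ∧ ∀ x ∉ B,
      (0 ≤ eval f (pt (r + m * x)) ↔ 0 ≤ eval f (pt (r + m * (x + 1)))) := by
    intro f
    by_cases hex : ∃ x, ¬ (0 ≤ eval f (pt (r + m * x)) ↔ 0 ≤ eval f (pt (r + m * (x + 1))))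
    · obtain ⟨x₀, h₀⟩ := hex
      refine ⟨{x₀}, by simp, fun x hx => ?_⟩
      rw [Finset.mem_singleton] at hx
      have e0 := hstep f (r + m * (x₀ + 1)) (r + m * x₀)
      have e1 := hstep f (r + m * x) (r + m * x₀)
      have e2 := hstep f (r + m * (x + 1)) (r + m * x₀)
      rw [show f.1 j * (r + m * (x₀ + 1) - (r + m * x₀)) = f.1 j * m by ring] at e0
      rw [show f.1 j * (r + m * x - (r + m * x₀)) = f.1 j * m * (x - x₀) by ring] at e1
      rw [show f.1 j * (r + m * (x + 1) - (r + m * x₀)) = f.1 j * m * (x + 1 - x₀) by ring] at e2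
      generalize f.1 j * (m : ℤ) = d at *
      rcases lt_or_gt_of_ne hx with h | h
      · rcases le_total 0 d with hd | hd
        · have : d * (x + 1 - x₀) ≤ 0 := mul_nonpos_of_nonneg_of_nonpos hd (by omega)
          have : d * (x - x₀) ≤ 0 := mul_nonpos_of_nonneg_of_nonpos hd (by omega)
          omega
        · have : 0 ≤ d * (x + 1 - x₀) := mul_nonneg_of_nonpos_of_nonpos hd (by omega)
          have : 0 ≤ d * (x - x₀) := mul_nonneg_of_nonpos_of_nonpos hd (by omega)
          omega
      · rcases le_total 0 d with hd | hd
        · have : d ≤ d * (x + 1 - x₀) := le_mul_of_one_le_right hd (by omega)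
          have : d ≤ d * (x - x₀) := le_mul_of_one_le_right hd (by omega)
          omega
        · have : -d ≤ -d * (x + 1 - x₀) := le_mul_of_one_le_right (by omega) (by omega)
          have : -d ≤ -d * (x - x₀) := le_mul_of_one_le_right (by omega) (by omega)
          rw [neg_mul] at *
          omega
    · push Not at hex
      exact ⟨∅, by simp, fun x _ => by simpa using hex x⟩
  choose B hB1 hB2 using hroot
  refine ⟨F.biUnion B, ?_, fun x hx => ?_⟩
  · calc (F.biUnion B).card ≤ F.card * 1 := Finset.card_biUnion_le_card_mul _ _ _ fun f _ => hB1 f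
      _ = F.card := mul_one _
  · have hsame : ∀ f ∈ F,
        (0 ≤ eval f (pt (r + m * x)) ↔ 0 ≤ eval f (pt (r + m * (x + 1)))) := fun f hf =>
      hB2 f x fun h => hx (Finset.mem_biUnion.2 ⟨f, hf, h⟩)
    have hcongr : ∀ (a b : ℤ), (m : ℤ) ∣ a - b → ∀ i, (m : ℤ) ∣ pt a i - pt b i := by
      intro a b hab i
      rw [hcoord]
      split_ifs
      · exact hab
      · exact dvd_zero _
    have h1 := hF _ _ (hcongr (r + m * x) (r + m * (x + 1)) ⟨-1, by ring⟩) hsame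
    have h2 := hF _ _ (hcongr (r + m * (x + 1)) (r + m * x) ⟨1, by ring⟩)
      fun f hf => (hsame f hf).symm
    simp only [mem_ofPred_eq, hpt] at h1 h2
    exact ⟨h1, h2⟩

/-- At least `k` integers satisfy `Q`. -/
def HasAtLeast (k : ℕ) (Q : ℤ → Prop) : Prop :=
  ∃ u : Fin k → ℤ, Function.Injective u ∧ ∀ i, Q (u i)

theorem HasAtLeast.le_card {k : ℕ} {Q : ℤ → Prop} (h : HasAtLeast k Q) {T : Finset ℤ}
    (hT : ∀ x, Q x → x ∈ T) : k ≤ T.card := by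
  obtain ⟨u, hu, hQ⟩ := h
  have := Finset.card_le_card (s := Finset.univ.image u) (t := T)
    (by intro x hx; obtain ⟨i, -, rfl⟩ := Finset.mem_image.1 hx; exact hT _ (hQ i))
  rwa [Finset.card_image_of_injective _ hu, Finset.card_fin] at this

theorem HasAtLeast.mono {k l : ℕ} {Q : ℤ → Prop} (h : HasAtLeast l Q) (hkl : k ≤ l) :
    HasAtLeast k Q := by
  obtain ⟨u, hu, hQ⟩ := h
  exact ⟨u ∘ Fin.castLE hkl, hu.comp (Fin.castLE_injective hkl), fun _ => hQ _⟩

/-- Counting up to a fixed number is a first-order operation. -/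
theorem DefPred.hasAtLeast (k : ℕ) {Q : ℤ → Y → Prop}
    (hQ : DefPred 𝒟 fun p : ℤ × Y => Q p.1 p.2) :
    DefPred 𝒟 fun y => HasAtLeast k fun x => Q x y := by
  have hinj : DefPred 𝒟 fun p : Y × (Fin k → ℤ) =>
      (∀ i j : Fin k, p.2 i = p.2 j → i = j) ∧ ∀ i, Q (p.2 i) p.1 :=
    .and (.forall_finite fun i => .forall_finite fun j =>
        .imp (.eq (.eval (.snd .id) i) (.eval (.snd .id) j)) (.const _))
      (.forall_finite fun i => hQ.comp₂ (.eval (.snd .id) i) (.fst .id))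
  exact hinj.ex (P := fun y (u : Fin k → ℤ) => (∀ i j : Fin k, u i = u j → i = j) ∧ ∀ i, Q (u i) y)

theorem intBoundary_subset {Q : ℤ → Prop} {B T : Finset ℤ} (hB : ∀ x ∉ B, (Q x ↔ Q (x + 1)))
    (hT : ∀ x, Q x ↔ x ∈ T) : intBoundary T ⊆ B := by
  intro x hx
  by_contra hxB
  rw [mem_intBoundary, ← hT, ← hT] at hx
  exact hx (hB x hxB)

/-- A set of integers with finite boundary that is infinite and coinfinite contains one of the two
ends of `ℤ` and misses the other, so that it meets suitable reflections of itself in finite sets as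
large as desired. -/
theorem exists_finite_inter_reflection {Q : ℤ → Prop} {B : Finset ℤ}
    (hB : ∀ x ∉ B, (Q x ↔ Q (x + 1))) (h₁ : {x | Q x}.Infinite) (h₂ : {x | ¬ Q x}.Infinite)
    (k : ℕ) : ∃ (t : ℤ) (T : Finset ℤ), (∀ x, (Q x ∧ Q (t - x)) ↔ x ∈ T) ∧ k ≤ T.card := by
  classical
  obtain ⟨b, hb⟩ : ∃ b : ℕ, ∀ x ∈ B, x.natAbs ≤ b :=
    ⟨∑ x ∈ B, x.natAbs, fun x hx =>
      Finset.single_le_sum (f := fun x : ℤ => x.natAbs) (fun _ _ => Nat.zero_le _) hx⟩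
  have hright : ∀ n : ℕ, Q (b + 1 + n) ↔ Q (b + 1) := by
    intro n
    induction n with
    | zero => simp
    | succ n ih =>
      rw [← ih, hB (b + 1 + n) (fun h => by have := hb _ h; omega)]
      push_cast
      rw [← add_assoc]
  have hleft : ∀ n : ℕ, Q (-(b : ℤ) - 1 - n) ↔ Q (-(b : ℤ) - 1) := by
    intro n
    induction n with
    | zero => simp
    | succ n ih =>
      rw [← ih, hB (-(b : ℤ) - 1 - (n + 1 : ℕ)) (fun h => by have := hb _ h; omega)]
      push_cast
      rw [show -(b : ℤ) - 1 - (n + 1) + 1 = -(b : ℤ) - 1 - n by ring]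
  have hright' : ∀ x : ℤ, b < x → (Q x ↔ Q (b + 1)) := fun x hx => by
    rw [← hright (x - b - 1).toNat]
    exact iff_of_eq (congrArg Q (by omega))
  have hleft' : ∀ x : ℤ, x < -b → (Q x ↔ Q (-(b : ℤ) - 1)) := fun x hx => by
    rw [← hleft (-x - b - 1).toNat]
    exact iff_of_eq (congrArg Q (by omega))
  have hfin : ∀ {R : ℤ → Prop}, (∀ x, R x → -(b : ℤ) ≤ x ∧ x ≤ b) → {x | R x}.Finite := fun h =>
    (Set.finite_Icc (-(b : ℤ)) b).subset fun x hx => h x hx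
  have main : ∀ (t : ℤ) (c d : ℤ), (∀ x, Q x ∧ Q (t - x) → c ≤ x ∧ x ≤ d) →
      ∀ T : Finset ℤ, (∀ x ∈ T, Q x ∧ Q (t - x)) → k ≤ T.card →
      ∃ (t : ℤ) (T : Finset ℤ), (∀ x, (Q x ∧ Q (t - x)) ↔ x ∈ T) ∧ k ≤ T.card := by
    intro t c d hcd T hT hk
    refine ⟨t, (Finset.Icc c d).filter fun x => Q x ∧ Q (t - x), fun x => ?_, hk.trans ?_⟩
    · rw [Finset.mem_filter, Finset.mem_Icc]
      exact ⟨fun h => ⟨hcd x h, h⟩, fun h => h.2⟩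
    · refine Finset.card_le_card fun x hx => ?_
      rw [Finset.mem_filter, Finset.mem_Icc]
      exact ⟨hcd x (hT x hx), hT x hx⟩
  by_cases hR : Q (b + 1) <;> by_cases hL : Q (-(b : ℤ) - 1)
  · refine absurd (hfin fun x hx => ?_) h₂
    by_contra hcon
    rcases lt_or_ge (b : ℤ) x with h | h
    · exact hx ((hright' x h).2 hR)
    · exact hx ((hleft' x (by omega)).2 hL)
  · have hlow : ∀ x, Q x → -(b : ℤ) ≤ x := fun x hx => by
      by_contra hcon
      exact hL ((hleft' x (by omega)).1 hx)
    refine main (2 * b + k + 1) (-b) (3 * b + k + 1) (fun x hx => ?_)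
      (Finset.Ico (b + 1 : ℤ) (b + 1 + k)) (fun x hx => ?_) (by simp)
    · have := hlow _ hx.1
      have := hlow _ hx.2
      omega
    · rw [Finset.mem_Ico] at hx
      exact ⟨(hright' x (by omega)).2 hR, (hright' _ (by omega)).2 hR⟩
  · have hup : ∀ x, Q x → x ≤ b := fun x hx => by
      by_contra hcon
      exact hR ((hright' x (by omega)).1 hx)
    refine main (-(2 * b + k + 1)) (-(3 * b + k + 1)) b (fun x hx => ?_)
      (Finset.Ico (-b - k : ℤ) (-b - k + k)) (fun x hx => ?_) (by simp)
    · have := hup _ hx.1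
      have := hup _ hx.2
      omega
    · rw [Finset.mem_Ico] at hx
      exact ⟨(hleft' x (by omega)).2 hL, (hleft' _ (by omega)).2 hL⟩
  · refine absurd (hfin fun x hx => ?_) h₁
    by_contra hcon
    rcases lt_or_ge (b : ℤ) x with h | h
    · exact hR ((hright' x h).1 hx)
    · exact hL ((hleft' x (by omega)).1 hx)

/-- If the order is not definable, then in every definable family the fibres are, on each residue
class of a suitable modulus, finite or cofinite with a uniform bound on the exceptions. -/
theorem exists_uniform_dichotomy (hord : ¬ DefPred 𝒟 fun x : ℤ => 0 ≤ x) {P : ℤ → Y → Prop}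
    (hP : DefPred 𝒟 fun p : ℤ × Y => P p.1 p.2) :
    ∃ m : ℕ, 0 < m ∧ ∃ K : ℕ, ∀ (y : Y) (r : ℤ),
      ¬ (HasAtLeast K (fun x => P (r + m * x) y) ∧ HasAtLeast K fun x => ¬ P (r + m * x) y) := by
  classical
  obtain ⟨m, hm, s, hs⟩ := exists_bounded_boundary hP
  refine ⟨m, hm, ?_⟩
  by_contra hcon
  push Not at hcon
  apply hord
  have hQ : DefPred 𝒟 fun p : ℤ × Y × ℤ => P (p.2.2 + m * p.1) p.2.1 :=
    hP.comp₂ (.add (.snd (.snd .id)) (.const_mul m (.fst .id))) (.fst (.snd .id))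
  -- A single infinite and coinfinite fibre already gives finite sets of every size by reflection;
  -- otherwise the fibres or their complements are finite, of unbounded size.
  by_cases hinf : ∃ (y : Y) (r : ℤ), {x | P (r + m * x) y}.Infinite ∧
      {x | ¬ P (r + m * x) y}.Infinite
  · obtain ⟨y, r, h1, h2⟩ := hinf
    have hQ' : DefPred 𝒟 fun p : ℤ × (Y × ℤ) × ℤ =>
        P (p.2.1.2 + m * p.1) p.2.1.1 ∧ P (p.2.1.2 + m * (p.2.2 - p.1)) p.2.1.1 :=
      .and (hQ.comp₂ (P := fun x (q : Y × ℤ) => P (q.2 + m * x) q.1) (.fst .id) (.fst (.snd .id)))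
        (hQ.comp₂ (P := fun x (q : Y × ℤ) => P (q.2 + m * x) q.1)
          (.sub (.snd (.snd .id)) (.fst .id)) (.fst (.snd .id)))
    refine nonneg_of_finite_fibres (2 * s) (P := fun x (q : (Y × ℤ) × ℤ) =>
      P (q.1.2 + m * x) q.1.1 ∧ P (q.1.2 + m * (q.2 - x)) q.1.1) hQ' fun k => ?_
    obtain ⟨B, hBs, hB⟩ := hs y r
    obtain ⟨t, T, hT, hk⟩ := exists_finite_inter_reflection hB h1 h2 k
    refine ⟨((y, r), t), T, hT, ?_, hk⟩
    have hsub : intBoundary T ⊆ B ∪ B.image fun x => t - x - 1 := by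
      refine intBoundary_subset (fun x hx => ?_) hT
      rw [Finset.mem_union, Finset.mem_image, not_or] at hx
      have h3 := hB (t - x - 1) fun h => hx.2 ⟨_, h, by ring⟩
      rw [hB x hx.1, show t - (x + 1) = t - x - 1 by ring, h3, sub_add_cancel]
    refine (Finset.card_le_card hsub).trans ((Finset.card_union_le _ _).trans ?_)
    have := Finset.card_image_le (s := B) (f := fun x => t - x - 1)
    omega
  · push Not at hinf
    by_cases hfin : ∀ k : ℕ, ∃ (y : Y) (r : ℤ), {x | P (r + m * x) y}.Finite ∧
        HasAtLeast k fun x => P (r + m * x) y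
    · refine nonneg_of_finite_fibres s (P := fun x (q : Y × ℤ) => P (q.2 + m * x) q.1) hQ
        fun k => ?_
      obtain ⟨y, r, hf, hk⟩ := hfin k
      obtain ⟨B, hBs, hB⟩ := hs y r
      have hT : ∀ x, P (r + m * x) y ↔ x ∈ hf.toFinset := fun x => by simp
      exact ⟨(y, r), hf.toFinset, hT,
        (Finset.card_le_card (intBoundary_subset hB hT)).trans hBs, hk.le_card fun x => (hT x).1⟩
    · push Not at hfin
      obtain ⟨k₁, hk₁⟩ := hfin
      refine nonneg_of_finite_fibres s (P := fun x (q : Y × ℤ) => ¬ P (q.2 + m * x) q.1) hQ.not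
        fun k => ?_
      obtain ⟨y, r, h1, h2⟩ := hcon (max k k₁)
      have hf : {x | ¬ P (r + m * x) y}.Finite := by
        by_contra hf
        refine hk₁ y r ?_ (h1.mono (le_max_right _ _))
        by_contra hf'
        exact hf (hinf y r hf')
      obtain ⟨B, hBs, hB⟩ := hs y r
      have hT : ∀ x, ¬ P (r + m * x) y ↔ x ∈ hf.toFinset := fun x => by simp
      exact ⟨(y, r), hf.toFinset, hT,
        (Finset.card_le_card (intBoundary_subset (fun x hx => not_congr (hB x hx)) hT)).trans hBs,
        (h2.mono (le_max_left _ _)).le_card fun x => (hT x).1⟩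

end Tame

/-! ### Counting traces in an ultrapower -/

section Traces

open Coordinates

variable (𝒟 : ∀ α : Type, ((α → ℤ) → Prop) → Prop) (U : Ultrafilter ℕ)
variable {X Y : Type} [Coordinates X] [Coordinates Y]

/-- Over any countable set of parameters, elements of the ultrapower of `X` (represented by
sequences) realize only countably many traces of each definable predicate. -/
def HasCountableTraces (X : Type) [Coordinates X] : Prop :=
  ∀ {Y : Type} [Coordinates Y] {P : X → Y → Prop}, DefPred 𝒟 (fun p : X × Y => P p.1 p.2) →
    ∀ {κ : Type} [Countable κ] (B : κ → ℕ → Y),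
      (range fun c : ℕ → X => {i | ∀ᶠ k in U, P (c k) (B i k)}).Countable

variable {𝒟 U} [DefinabilityClass 𝒟]

theorem HasAtLeast.succ {K : ℕ} {Q : ℤ → Prop} {x : ℤ} (h : HasAtLeast K fun z => Q z ∧ z ≠ x)
    (hx : Q x) : HasAtLeast (K + 1) Q := by
  obtain ⟨u, hu, hQ⟩ := h
  refine ⟨Fin.cons x u, Fin.cons_injective_iff.2 ⟨?_, hu⟩, fun i => ?_⟩
  · rintro ⟨i, hi⟩
    exact (hQ i).2 hi
  · refine Fin.cases ?_ (fun j => ?_) i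
    · exact hx
    · exact (hQ j).1

/-- Traces of tuples `(c, d)` with `c` algebraic over `d` and the countable set of parameters. If
some parameter separates `c` from another root of the algebraic condition `E`, then that parameter
can be used to lower the number of roots; otherwise the trace is determined by `d`. -/
theorem countable_traces_of_algebraic (hX : HasCountableTraces 𝒟 U X) (K : ℕ) :
    ∀ {Z : Type} [Coordinates Z] {P : ℤ → X → Y → Prop} {E : ℤ → X → Z → Prop},
      DefPred 𝒟 (fun p : ℤ × X × Y => P p.1 p.2.1 p.2.2) →
      DefPred 𝒟 (fun p : ℤ × X × Z => E p.1 p.2.1 p.2.2) →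
      (∀ d e, ¬ HasAtLeast (K + 1) fun x => E x d e) →
      ∀ {κ lam : Type} [Countable κ] [Countable lam] (B : κ → ℕ → Y) (A : lam → ℕ → Z),
        {S : Set κ | ∃ (c : ℕ → ℤ) (d : ℕ → X) (l : lam), (∀ᶠ k in U, E (c k) (d k) (A l k)) ∧
          S = {i | ∀ᶠ k in U, P (c k) (d k) (B i k)}}.Countable := by
  induction K with
  | zero =>
    intro Z _ P E _ _ hE κ lam _ _ B A
    convert Set.countable_empty
    rw [Set.eq_empty_iff_forall_notMem]
    rintro S ⟨c, d, l, hc, -⟩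
    obtain ⟨k, hk⟩ := hc.exists
    exact hE _ _ ⟨fun _ => c k, fun i j _ => Fin.ext (by omega), fun _ => hk⟩
  | succ K ih =>
    intro Z _ P E hP hE hK κ lam _ _ B A
    have hE' : ∀ ε : Prop, DefPred 𝒟 fun p : ℤ × X × Z × Y =>
        E p.1 p.2.1 p.2.2.1 ∧ (P p.1 p.2.1 p.2.2.2 ↔ ε) ∧
          ∃ x : ℤ, E x p.2.1 p.2.2.1 ∧ ¬ (P x p.2.1 p.2.2.2 ↔ ε) := by
      intro ε
      refine .and (hE.comp₃ (.fst .id) (.fst (.snd .id)) (.fst (.snd (.snd .id)))) (.and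
        (.iff (hP.comp₃ (.fst .id) (.fst (.snd .id)) (.snd (.snd (.snd .id)))) (.const ε))
        (.ex (.and ?_ (.not (.iff ?_ (.const ε))))))
      · exact hE.comp₃ (.snd .id) (.fst (.snd (.fst .id))) (.fst (.snd (.snd (.fst .id))))
      · exact hP.comp₃ (.snd .id) (.fst (.snd (.fst .id))) (.snd (.snd (.snd (.fst .id))))
    have hsplit : ∀ ε : Prop, _ := fun ε =>
      ih (Z := Z × Y) (E := fun x d q => E x d q.1 ∧ (P x d q.2 ↔ ε) ∧
        ∃ x' : ℤ, E x' d q.1 ∧ ¬ (P x' d q.2 ↔ ε)) hP (hE' ε) (by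
          intro d e h
          obtain ⟨x, hx, hxε⟩ : ∃ x', E x' d e.1 ∧ ¬ (P x' d e.2 ↔ ε) := by
            obtain ⟨u, -, hu⟩ := h
            exact (hu 0).2.2
          refine hK d e.1 (HasAtLeast.succ (x := x) ?_ hx)
          obtain ⟨u, hu, h'⟩ := h
          refine ⟨u, hu, fun i => ⟨(h' i).1, fun hi => hxε ?_⟩⟩
          rw [← hi]
          exact (h' i).2.1)
        B (fun (p : lam × κ) k => (A p.1 k, B p.2 k))
    have hdet := fun l : lam => hX (Y := Z × Y)
      (P := fun d q => ∃ x : ℤ, E x d q.1 ∧ P x d q.2)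
      (.ex (.and (hE.comp₃ (.snd .id) (.fst (.fst .id)) (.fst (.snd (.fst .id))))
        (hP.comp₃ (.snd .id) (.fst (.fst .id)) (.snd (.snd (.fst .id))))))
      (fun i k => (A l k, B i k))
    refine ((countable_iUnion hdet).union ((hsplit True).union (hsplit False))).mono ?_
    rintro S ⟨c, d, l, hc, rfl⟩
    by_cases hall : ∀ i, ∀ᶠ k in U, ∀ x, E x (d k) (A l k) →
        (P x (d k) (B i k) ↔ P (c k) (d k) (B i k))
    · refine Or.inl (mem_iUnion.2 ⟨l, d, ?_⟩)
      ext i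
      refine eventually_congr ?_
      filter_upwards [hc, hall i] with k h1 h2
      exact ⟨fun ⟨x, hx, hPx⟩ => (h2 x hx).1 hPx, fun h => ⟨c k, h1, h⟩⟩
    · push Not at hall
      obtain ⟨i, hi⟩ := hall
      refine Or.inr ?_
      by_cases hε : ∀ᶠ k in U, P (c k) (d k) (B i k)
      · refine Or.inl ⟨c, d, (l, i), ?_, rfl⟩
        filter_upwards [hc, hi, hε] with k h1 ⟨x, hx, h2⟩ h3
        refine ⟨h1, by simpa using h3, x, hx, ?_⟩
        tauto
      · refine Or.inr ⟨c, d, (l, i), ?_, rfl⟩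
        rw [← Ultrafilter.eventually_not] at hε
        filter_upwards [hc, hi, hε] with k h1 ⟨x, hx, h2⟩ h3
        refine ⟨h1, by simpa using h3, x, hx, ?_⟩
        tauto


/-- The first coordinate of a tuple is either generic over the others and all the parameters, so
that its trace depends only on its residue class and on the other coordinates, or algebraic over the
others and some parameter. -/
theorem HasCountableTraces.int_prod (hord : ¬ DefPred 𝒟 fun x : ℤ => 0 ≤ x)
    (hX : HasCountableTraces 𝒟 U X) : HasCountableTraces 𝒟 U (ℤ × X) := by
  intro Y _ P hP κ _ B
  have hP' : DefPred 𝒟 fun p : ℤ × X × Y => P (p.1, p.2.1) p.2.2 :=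
    hP.comp₂ (.pair (.fst .id) (.fst (.snd .id))) (.snd (.snd .id))
  obtain ⟨m, hm, K, hK⟩ := exists_uniform_dichotomy hord
    (P := fun x (q : X × Y) => P (x, q.1) q.2) hP'
  -- The predicate `P (·, d) b` holds for generic elements of the residue class of `r`.
  let G : ℤ → X → Y → Prop := fun r d b => HasAtLeast K fun x => P (r + m * x, d) b
  have hG : ∀ r, DefPred 𝒟 fun p : X × Y => G r p.1 p.2 := fun r =>
    DefPred.hasAtLeast K (Q := fun x (q : X × Y) => P (r + m * x, q.1) q.2)
      (hP.comp₂ (.pair (.add (.const r) (.const_mul m (.fst .id))) (.fst (.snd .id)))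
        (.snd (.snd .id)))
  let E : ℤ → ℤ → X → Y → Prop := fun r x d b => (m : ℤ) ∣ x - r ∧ ¬ (P (x, d) b ↔ G r d b)
  have hE : ∀ r, DefPred 𝒟 fun p : ℤ × X × Y => E r p.1 p.2.1 p.2.2 := fun r =>
    .and (.congruence (.fst .id) m r)
      (.not (.iff hP' ((hG r).comp₂ (.fst (.snd .id)) (.snd (.snd .id)))))
  have hEK : ∀ r d b, ¬ HasAtLeast (K + 1) fun x => E r x d b := by
    intro r d b h
    obtain ⟨u, hu, huE⟩ := h.mono (Nat.le_succ K)
    choose v hv using fun i => (huE i).1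
    have huv : ∀ i, u i = r + m * v i := fun i => by rw [← hv]; ring
    have hinj : Function.Injective v := fun i j hij => hu (by rw [huv, huv, hij])
    by_cases hGr : G r d b
    · refine hK (d, b) r ⟨hGr, v, hinj, fun i => ?_⟩
      have := (huE i).2
      rw [huv] at this
      tauto
    · refine hGr ⟨v, hinj, fun i => ?_⟩
      have := (huE i).2
      rw [huv] at this
      tauto
  have hgen := fun r : Fin m => hX (hG r) B
  have halg := fun r : Fin m => countable_traces_of_algebraic (U := U) hX K
    (P := fun x d b => P (x, d) b) hP' (hE r) (hEK r) B B
  refine (countable_iUnion fun r => (hgen r).union (halg r)).mono ?_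
  rintro _ ⟨c, rfl⟩
  obtain ⟨r, hr⟩ : ∃ r : Fin m, ∀ᶠ k in U, (m : ℤ) ∣ (c k).1 - (r : ℕ) := by
    rw [← Ultrafilter.eventually_exists_iff]
    refine Eventually.of_forall fun k => ?_
    have hm' : (0 : ℤ) < m := by exact_mod_cast hm
    have h0 := Int.emod_nonneg (c k).1 hm'.ne'
    have h1 := Int.emod_lt_of_pos (c k).1 hm'
    refine ⟨⟨((c k).1 % m).toNat, by omega⟩, ?_⟩
    rw [Int.toNat_of_nonneg h0]
    exact Int.dvd_self_sub_emod
  refine mem_iUnion.2 ⟨r, ?_⟩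
  by_cases hall : ∀ i, ∀ᶠ k in U, (P (c k) (B i k) ↔ G r (c k).2 (B i k))
  · refine Or.inl ⟨fun k => (c k).2, ?_⟩
    ext i
    exact eventually_congr ((hall i).mono fun k h => h.symm)
  · push Not at hall
    obtain ⟨i, hi⟩ := hall
    refine Or.inr ⟨fun k => (c k).1, fun k => (c k).2, i, ?_, rfl⟩
    filter_upwards [hr, hi] with k h1 h2
    refine ⟨h1, ?_⟩
    change ¬ (P (c k) (B i k) ↔ _)
    tauto

theorem hasCountableTraces_fin (hord : ¬ DefPred 𝒟 fun x : ℤ => 0 ≤ x) (n : ℕ) :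
    HasCountableTraces 𝒟 U (Fin n → ℤ) := by
  induction n with
  | zero =>
    intro Y _ P _ κ _ B
    exact Set.countable_range _
  | succ n ih =>
    intro Y _ P hP κ _ B
    refine (ih.int_prod hord (P := fun q b => P (Fin.cons q.1 q.2) b)
      (hP.comp₂ ((DefFun.of_isReindexing .cons).comp (.fst .id)) (.snd .id)) B).mono ?_
    rintro _ ⟨c, rfl⟩
    refine ⟨fun k => (c k 0, Fin.tail (c k)), ?_⟩
    simp [Fin.cons_self_tail]

/-- A definable predicate with the order property has uncountably many traces over a countable set
of parameters of the ultrapower: rational cuts of long finite orders have a trace for each real. -/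
theorem nonneg_of_order_property {n : ℕ} {P : (Fin n → ℤ) → Y → Prop}
    (hP : DefPred 𝒟 fun p : (Fin n → ℤ) × Y => P p.1 p.2)
    (h : ∀ k : ℕ, ∃ (a : Fin k → Fin n → ℤ) (b : Fin k → Y), ∀ i j, P (a i) (b j) ↔ i < j) :
    DefPred 𝒟 fun x : ℤ => 0 ≤ x := by
  by_contra hord
  choose a b hab using fun k : ℕ => h (k + 1)
  let idx : Ico (0 : ℝ) 1 → ∀ k : ℕ, Fin (k + 1) := fun α k =>
    ⟨⌊(α : ℝ) * (k + 1 : ℕ)⌋₊, by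
      rw [Nat.floor_lt (mul_nonneg α.2.1 (Nat.cast_nonneg _))]
      exact mul_lt_of_lt_one_left (by positivity) α.2.2⟩
  let κ := {q : ℚ // (q : ℝ) ∈ Ico (0 : ℝ) 1}
  let real : κ → Ico (0 : ℝ) 1 := fun q => ⟨q.1, q.2⟩
  let U := hyperfilter ℕ
  have hcount := hasCountableTraces_fin (U := U) hord n hP fun (q : κ) k => b k (idx (real q) k)
  have htrace : ∀ (α : Ico (0 : ℝ) 1) (q : κ),
      (∀ᶠ k in U, P (a k (idx α k)) (b k (idx (real q) k))) ↔ (α : ℝ) < q.1 := by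
    intro α q
    simp only [hab, Fin.lt_def, idx, real]
    constructor
    · intro hev
      obtain ⟨k, hk⟩ := hev.exists
      by_contra hle
      exact absurd hk (not_lt.2 (Nat.floor_le_floor (by gcongr; exact not_lt.1 hle)))
    · intro hlt
      obtain ⟨n₀, hn₀⟩ := exists_nat_gt (1 / ((q.1 : ℝ) - α))
      refine Nat.hyperfilter_le_atTop ?_
      filter_upwards [eventually_ge_atTop n₀] with k hk
      have hpos : 0 < (q.1 : ℝ) - α := sub_pos.2 hlt
      rw [div_lt_iff₀ hpos] at hn₀
      have hk' : (n₀ : ℝ) ≤ (k + 1 : ℕ) := by exact_mod_cast hk.trans (Nat.le_succ k)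
      have h1 : (1 : ℝ) ≤ (k + 1 : ℕ) * ((q.1 : ℝ) - α) :=
        hn₀.le.trans (by gcongr)
      rw [Nat.lt_iff_add_one_le, Nat.le_floor_iff (mul_nonneg q.2.1 (Nat.cast_nonneg _))]
      have h2 := Nat.floor_le (mul_nonneg α.2.1 (Nat.cast_nonneg (k + 1)))
      push_cast at *
      linarith
  have hinj : Function.Injective fun α : Ico (0 : ℝ) 1 =>
      {q : κ | ∀ᶠ k in U, P (a k (idx α k)) (b k (idx (real q) k))} := by
    have hlt : ∀ α β : Ico (0 : ℝ) 1, α < β → ∃ q : κ, (α : ℝ) < q.1 ∧ ¬ (β : ℝ) < q.1 := by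
      intro α β hαβ
      obtain ⟨q, h1, h2⟩ := exists_rat_btwn (Subtype.coe_lt_coe.2 hαβ)
      exact ⟨⟨q, α.2.1.trans h1.le, h2.trans β.2.2⟩, h1, not_lt.2 h2.le⟩
    intro α β hαβ
    simp only [htrace, Set.ext_iff, mem_ofPred_eq] at hαβ
    rcases lt_trichotomy α β with hl | he | hl
    · obtain ⟨q, h1, h2⟩ := hlt α β hl
      exact absurd ((hαβ q).1 h1) h2
    · exact he
    · obtain ⟨q, h1, h2⟩ := hlt β α hl
      exact absurd ((hαβ q).2 h1) h2
  have hcountable : Countable (Ico (0 : ℝ) 1) := by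
    have := hcount.mono (s₁ := range fun α : Ico (0 : ℝ) 1 =>
      {q : κ | ∀ᶠ k in U, P (a k (idx α k)) (b k (idx (real q) k))})
      (by rintro _ ⟨α, rfl⟩; exact ⟨fun k => a k (idx α k), rfl⟩)
    exact (Equiv.ofInjective _ hinj).countable_iff.2 this.to_subtype
  have := (Set.countable_coe_iff.1 hcountable).measure_zero MeasureTheory.volume
  simp at this

end Traces

/-! ### Transfer between the integers and the elementary extension -/

section Transfer

open Coordinates

/-- The inclusion of the language `{+, 0, 1}` in the language `{+, 0, 1, <}`. -/
def presburgerToOrd : FirstOrder.Language.presburger →ᴸ ordPresburger :=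
  ⟨fun _ f => f, fun _ R => Empty.elim R⟩

instance {M : Type*} [Zero M] [One M] [Add M] [LT M] : presburgerToOrd.IsExpansionOn M where
  map_onFunction f x := by cases f <;> rfl
  map_onRelation R := Empty.elim R

/-- The formula `x_i < x_j`. -/
def ltFormula {α : Type} (i j : α) : ordPresburger.Formula α :=
  Relations.formula₂ (OrdPresburgerRel.lt : ordPresburger.Relations 2) (Term.var i) (Term.var j)

@[simp] theorem realize_ltFormula {M : Type*} [Zero M] [One M] [Add M] [LT M] {α : Type} (i j : α)
    (v : α → M) : (ltFormula i j).Realize v ↔ v i < v j :=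
  Formula.realize_rel₂

variable {N : Type w} [Zero N] [One N] [Add N] [LT N]

/-- Universal statements about tuples of any finite index type transfer from `ℤ` to `N`. -/
theorem realize_of_elementaryEmbedding (f : ℤ ↪ₑ[ordPresburger] N) {α : Type} [Finite α]
    (χ : ordPresburger.Formula α) (h : ∀ v : α → ℤ, χ.Realize v) (v : α → N) : χ.Realize v := by
  have h1 : ((χ.relabel (Sum.inr : α → Empty ⊕ α)).iAlls α).Realize (Empty.elim : Empty → ℤ) := by
    rw [Formula.realize_iAlls]
    intro w
    rw [Formula.realize_relabel]
    exact h _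
  rw [← f.map_formula, Formula.realize_iAlls] at h1
  simpa [Formula.realize_relabel] using h1 v

variable (N) (L : FirstOrder.Language.{u, v}) [L.Structure N]

/-- The predicates on tuples of integers that are defined by a formula of `(ℤ, +, 0, 1, <)` whose
interpretation in `N` is `∅`-definable in the `L`-structure on `N`. This is the trace on `ℤ` of the
`L`-structure. -/
def DefinableInBoth (α : Type) (P : (α → ℤ) → Prop) : Prop :=
  ∃ (ψ : ordPresburger.Formula α) (θ : L.Formula α),
    (∀ v : α → ℤ, ψ.Realize v ↔ P v) ∧ ∀ v : α → N, θ.Realize v ↔ ψ.Realize v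

variable {N L}

theorem DefinableInBoth.of_presburger
    (h : IsReductOver (∅ : Set N) FirstOrder.Language.presburger L)
    {n : ℕ} (hn : 1 ≤ n) (χ : FirstOrder.Language.presburger.Formula (Fin n)) :
    DefinableInBoth N L (Fin n) χ.Realize := by
  obtain ⟨θ, hθ⟩ := Set.empty_definable_iff.1
    (h n hn {v | χ.Realize v} (Set.empty_definable_iff.2 ⟨χ, rfl⟩))
  refine ⟨presburgerToOrd.onFormula χ, θ, fun v => LHom.realize_onFormula _ _, fun v => ?_⟩
  rw [LHom.realize_onFormula]
  exact (Set.ext_iff.1 hθ v).symm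

theorem definabilityClass_definableInBoth
    (h : IsReductOver (∅ : Set N) FirstOrder.Language.presburger L) :
    DefinabilityClass (DefinableInBoth N L) where
  not := by
    rintro α P ⟨ψ, θ, h₁, h₂⟩
    exact ⟨ψ.not, θ.not, by simp [h₁], by simp [h₂]⟩
  and := by
    rintro α P Q ⟨ψ, θ, h₁, h₂⟩ ⟨ψ', θ', h₁', h₂'⟩
    exact ⟨ψ ⊓ ψ', θ ⊓ θ', by simp [h₁, h₁'], by simp [h₂, h₂']⟩
  reindex := by
    rintro α β P f ⟨ψ, θ, h₁, h₂⟩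
    exact ⟨ψ.relabel f, θ.relabel f, by simp [h₁, Formula.realize_relabel],
      by simp [h₂, Formula.realize_relabel]⟩
  ex := by
    rintro α β P _ ⟨ψ, θ, h₁, h₂⟩
    exact ⟨ψ.iExs β, θ.iExs β, by simp [h₁, Formula.realize_iExs],
      by simp [h₂, Formula.realize_iExs]⟩
  eq := by
    convert DefinableInBoth.of_presburger h (n := 2) (by norm_num)
      (Term.equal (Term.var 0) (Term.var 1)) using 2
    simp
  one := by
    convert DefinableInBoth.of_presburger h (n := 1) le_rfl
      (Term.equal (Term.var 0) 1) using 2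
    simp
  add := by
    convert DefinableInBoth.of_presburger h (n := 3) (by norm_num)
      (Term.equal (Term.var 0 + Term.var 1) (Term.var 2)) using 2
    simp
  det := by
    rintro n P ⟨ψ, θ, h₁, -⟩
    refine PatternDetermined.of_definable_ordPresburger (Set.empty_definable_iff.2 ⟨ψ, ?_⟩)
    ext v
    exact (h₁ v).symm

/-- Any definition of the order of `ℤ` in the trace on `ℤ` of the `L`-structure of `N` also
defines the order of `N`. -/
theorem definable_lt_of_nonneg (f : ℤ ↪ₑ[ordPresburger] N)
    (h : IsReductOver (∅ : Set N) FirstOrder.Language.presburger L)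
    (hord : DefPred (DefinableInBoth N L) fun x : ℤ => 0 ≤ x) :
    (∅ : Set N).Definable L {x : Fin 2 → N | x 0 < x 1} := by
  have := definabilityClass_definableInBoth h
  have hlt : DefPred (DefinableInBoth N L) fun x : Fin 2 → ℤ => 0 ≤ x 1 - x 0 - 1 :=
    hord.comp (.sub (.sub (.eval .id 1) (.eval .id 0)) (.const 1))
  obtain ⟨ψ, θ, h₁, h₂⟩ := hlt
  refine Set.empty_definable_iff.2 ⟨θ, ?_⟩
  ext v
  have hv := realize_of_elementaryEmbedding f (ψ.iff
      (ltFormula (0 : Fin 2) (1 : Fin 2))) (fun v => by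
    rw [Formula.realize_iff, h₁, realize_ltFormula]
    change 0 ≤ v (1 : Fin 2) - v (0 : Fin 2) - 1 ↔ _
    omega) v
  rw [Formula.realize_iff, realize_ltFormula] at hv
  exact hv.symm.trans (h₂ v).symm

theorem IsReductOver.definable_of_finite {M : Type*} {L₁ L₂ : FirstOrder.Language}
    [L₁.Structure M] [L₂.Structure M] (h : IsReductOver (∅ : Set M) L₁ L₂) {α : Type} [Finite α]
    [Nonempty α] {s : Set (α → M)} (hs : (∅ : Set M).Definable L₁ s) :
    (∅ : Set M).Definable L₂ s := by
  obtain ⟨n, ⟨e⟩⟩ := Finite.exists_equiv_fin α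
  have hn : 1 ≤ n := (e (Classical.arbitrary α)).pos
  convert (h n hn _ (hs.preimage_comp e)).preimage_comp e.symm using 1
  ext v
  simp [Function.comp_assoc]

/-- An expansion of `(N, +, 0, 1)` defining the order is an expansion of `(N, +, 0, 1, <)`. -/
theorem isReductOver_of_definable_lt
    (h : IsReductOver (∅ : Set N) FirstOrder.Language.presburger L)
    (hlt : (∅ : Set N).Definable L {x : Fin 2 → N | x 0 < x 1}) :
    IsReductOver (∅ : Set N) ordPresburger L := by
  intro n _ s hs
  refine definable_of_definable_symbols ordPresburger L (fun k F => ?_) (fun k R => ?_) hs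
  · convert h.definable_of_finite
      (DefinableFun.fun_symbol (L := FirstOrder.Language.presburger) (M := N) F) using 2
    cases F <;> rfl
  · cases R
    exact hlt

/-- The formula expressing that `ψ` orders a given sequence of `k` pairs of tuples. -/
noncomputable def orderFormula (k : ℕ) {m n : ℕ} (ψ : ordPresburger.Formula (Fin m ⊕ Fin n)) :
    ordPresburger.Formula ((Fin k × Fin m) ⊕ (Fin k × Fin n)) :=
  Formula.iInf fun p : Fin k × Fin k =>
    if p.1 < p.2 then ψ.relabel (Sum.map (Prod.mk p.1) (Prod.mk p.2))
    else (ψ.relabel (Sum.map (Prod.mk p.1) (Prod.mk p.2))).not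

theorem realize_orderFormula {M : Type*} [Zero M] [One M] [Add M] [LT M] {k m n : ℕ}
    {ψ : ordPresburger.Formula (Fin m ⊕ Fin n)} {v : (Fin k × Fin m) ⊕ (Fin k × Fin n) → M} :
    (orderFormula k ψ).Realize v ↔ ∀ i j,
      ψ.Realize (Sum.elim (fun l => v (.inl (i, l))) (fun l => v (.inr (j, l)))) ↔ i < j := by
  have hg : ∀ i j, v ∘ Sum.map (Prod.mk i) (Prod.mk j) =
      Sum.elim (fun l => v (.inl (i, l))) (fun l => v (.inr (j, l))) := by
    intro i j
    ext l
    rcases l with l | l <;> rfl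
  simp only [orderFormula, Formula.realize_iInf, Prod.forall]
  refine forall₂_congr fun i j => ?_
  split_ifs with hij <;> simp [Formula.realize_relabel, hg, hij]

/-- A formula of the `L`-structure with the order property gives such a formula on its trace on
`ℤ`, where the order becomes definable. -/
theorem definable_nonneg_of_isUnstable (f : ℤ ↪ₑ[ordPresburger] N)
    (h : IsReductOver (∅ : Set N) FirstOrder.Language.presburger L)
    (h' : IsReductOver (∅ : Set N) L ordPresburger) (hL : IsUnstable L N) :
    DefPred (DefinableInBoth N L) fun x : ℤ => 0 ≤ x := by
  have := definabilityClass_definableInBoth h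
  obtain ⟨m, n, φ, hφ⟩ := hL
  -- A dummy variable makes the tuple of all variables nonempty.
  let φ' : L.Formula (Fin m ⊕ Fin (n + 1)) := φ.relabel (Sum.map id Fin.castSucc)
  obtain ⟨ψ, hψ⟩ := Set.empty_definable_iff.1
    (h'.definable_of_finite (s := {v | φ'.Realize v}) (Set.empty_definable_iff.2 ⟨φ', rfl⟩))
  have hψ' : ∀ v, φ'.Realize v ↔ ψ.Realize v := fun v => Set.ext_iff.1 hψ v
  have hP : DefPred (DefinableInBoth N L) fun p : (Fin m → ℤ) × (Fin (n + 1) → ℤ) =>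
      ψ.Realize (Sum.elim p.1 p.2) := by
    refine ⟨ψ, φ', fun v => ?_, hψ'⟩
    exact iff_of_eq (congrArg ψ.Realize (Sum.elim_comp_inl_inr v).symm)
  refine nonneg_of_order_property (P := fun a b => ψ.Realize (Sum.elim a b)) hP fun k => ?_
  by_contra hcon
  obtain ⟨a, b, hab⟩ := hφ k
  refine realize_of_elementaryEmbedding f (orderFormula k ψ).not (fun v => ?_)
    (Sum.elim (fun p => a p.1 p.2) (fun p => (Fin.snoc (b p.1) 0 : Fin (n + 1) → N) p.2)) ?_
  · rw [Formula.realize_not, realize_orderFormula]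
    exact fun h => hcon ⟨_, _, h⟩
  · refine realize_orderFormula.2 fun i j => ?_
    rw [← hab, ← hψ', Formula.realize_relabel]
    refine iff_of_eq (congrArg φ.Realize ?_)
    ext l
    rcases l with l | l <;> simp

end Transfer

theorem mainTheorem6 {N : Type w} [Zero N] [One N] [Add N] [LT N]
    (hN : Nonempty (ℤ ↪ₑ[ordPresburger] N)) :
    (IsUnstable ordPresburger N ∧
      IsProperExpansionOver (∅ : Set N) ∅ ordPresburger FirstOrder.Language.presburger) ∧
    ∀ (L : FirstOrder.Language.{u, v}) [L.Structure N],
      IsUnstable L N →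
      IsProperExpansionOver (∅ : Set N) ∅ L FirstOrder.Language.presburger →
      IsReductOver (∅ : Set N) L ordPresburger →
      InterdefinableOver (∅ : Set N) L ordPresburger := by
  obtain ⟨f⟩ := hN
  have hf : ∀ a b : ℤ, f a < f b ↔ a < b := fun a b => by
    have := f.map_formula (ltFormula (0 : Fin 2) 1) ![a, b]
    rw [realize_ltFormula, realize_ltFormula] at this
    exact this
  refine ⟨⟨?_, ?_, fun h => ?_⟩, fun L _ hL hexp hred => ⟨hred, ?_⟩⟩
  · refine ⟨1, 1, ltFormula (Sum.inl 0) (Sum.inr 0), fun k =>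
      ⟨fun i _ => f (i : ℕ), fun j _ => f (j : ℕ), fun i j => ?_⟩⟩
    simp [hf]
  · intro n _ s hs
    exact hs.map_expansion presburgerToOrd
  · obtain ⟨χ, hχ⟩ := Set.empty_definable_iff.1 (h 2 (by norm_num) {x | x 0 < x 1}
      (Set.empty_definable_iff.2 ⟨ltFormula 0 1, by ext; simp⟩))
    refine not_definable_lt_presburger (Set.empty_definable_iff.2 ⟨χ, ?_⟩)
    ext v
    have h1 := f.map_formula (presburgerToOrd.onFormula χ) v
    rw [LHom.realize_onFormula, LHom.realize_onFormula] at h1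
    exact (hf _ _).symm.trans ((Set.ext_iff.1 hχ (f ∘ v)).trans h1)
  · exact isReductOver_of_definable_lt hexp.1
      (definable_lt_of_nonneg f hexp.1 (definable_nonneg_of_isUnstable f hexp.1 hred hL))
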